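/- Let $G_{n,2}$ be the Grassmann manifold of two-dimensional linear subspaces of $\mathbb{C}^n$, with the coordinatewise actions of the compact torus $T^n=(S^1)^n$ and of the algebraic torus $(\mathbb{C}^*)^n$, and let $X_n=G_{n,2}/T^n$. The diagonal circle $S^1\subset T^n$ acts trivially. A point $[L]\in X_n$ is called *critical* if the stabilizer of $L$ in $T^n/S^1$ is nontrivial. For a set $\sigma$ of pairs $i<j$ let $W_\sigma\subset G_{n,2}$ be the set of planes $L$ whose Plücker coordinates satisfy $P^{ij}(L)\neq 0$ for $(i,j)\in\sigma$ and $P^{ij}(L)=0$ for $(i,j)\notin\sigma$. The nonempty $W_\sigma$ are the *strata*, and $F_\sigma=W_\sigma/(\mathbb{C}^*)^n$, with the quotient topology, is the *space of parameters* of $W_\sigma$. The main stratum is the one for which all $P^{ij}$, $i<j$, are nonzero. Fix $a<b$ and the chart $M_{ab}=\{P^{ab}\ne 0\}$. A plane $L\in M_{ab}$ has a unique basis $z,w$ with $z_a=1$, $z_b=0$, $w_a=0$, $w_b=1$; consider, for points $(c_{pq}:c'_{pq})_{p<q}$ of $(\mathbb{C}P^1)^{\binom{n-2}{2}}$ with $p,q\in\{1,\dots,n\}\setminus\{a,b\}$,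 the equations $$c'_{pq}\,z_pw_q=c_{pq}\,z_qw_p\qquad(p<q).\tag{1}$$ Let $\bar F_n$ be the closure of the set of solutions of (1) given by the points of the main stratum. For $S\subset\{1,\dots,n\}\setminus\{a,b\}$ with $|S|\ge 3$ let $\bar F_S\subset\bar F_n$ be given by $(c_{pq}:c'_{pq})=(1:1)$ for all $p<q$ in $S$. The *universal space of parameters* $\mathcal{F}_n$ is the wonderful compactification of $\bar F_n$ with building set $\{\bar F_S\}$, that is, the closure of $\bar F_n\setminus\bigcup_S\bar F_S$ in the product of the blow-ups of $\bar F_n$ along the $\bar F_S$. For a stratum $W_\sigma\subset M_{ab}$, the *virtual space of parameters* $\tilde F_\sigma\subset\mathcal{F}_n$ is the set of those points of $\mathcal{F}_n$ whose image in $\bar F_n$ satisfies (1) for some $L\in W_\sigma$. (Up to homeomorphism, $\tilde F_\sigma$ does not depend on the chart $M_{ab}\supset W_\sigma$.) A point $x\in X_n$ is called *singular* if, for the stratum $W_\sigma$ with $x\in W_\sigma/T^n$, the space $F_\sigma$ is not homeomorphic to $\tilde F_\sigma$, taken in any chart $M_{ab}$ that contains $W_\sigma$. **Proposition.** For $n\ge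 5$, every critical point of $X_n$ is a singular point of $X_n$. -/

import Mathlib

open scoped LinearAlgebra.Projectivization

namespace GrassmannOrbit

noncomputable section

/-! ## The Grassmann manifold and the torus actions -/

/-- The Grassmann manifold `G_{n,2}` of two-dimensional linear subspaces of `ℂⁿ`. -/
def Grassmannian (n : ℕ) : Type :=
  {L : Submodule ℂ (Fin n → ℂ) // Module.finrank ℂ L = 2}

/-- The 2-frames in `ℂⁿ`, that is, pairs of linearly independent vectors. -/
abbrev Frame (n : ℕ) : Type := {v : Fin 2 → Fin n → ℂ // LinearIndependent ℂ v}

/-- The plane spanned by a 2-frame. -/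
def Frame.plane {n : ℕ} (v : Frame n) : Grassmannian n :=
  ⟨Submodule.span ℂ (Set.range v.1), by simpa using finrank_span_eq_card v.2⟩

/-- The usual topology of `G_{n,2}`: the quotient topology from the space of 2-frames. -/
instance (n : ℕ) : TopologicalSpace (Grassmannian n) :=
  TopologicalSpace.coinduced Frame.plane inferInstance

/-- The diagonal linear automorphism `x ↦ (t₁ x₁, …, tₙ xₙ)` of `ℂⁿ`. -/
def diagEquiv {n : ℕ} (t : Fin n → ℂˣ) : (Fin n → ℂ) ≃ₗ[ℂ] (Fin n → ℂ) :=
  LinearEquiv.piCongrRight fun i => LinearEquiv.smulOfUnit (t i)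

@[simp] theorem diagEquiv_apply {n : ℕ} (t : Fin n → ℂˣ) (x : Fin n → ℂ) (i : Fin n) :
    diagEquiv t x i = (t i : ℂ) * x i := rfl

/-- The action of the algebraic torus `(ℂ^*)ⁿ` on `G_{n,2}`. -/
instance (n : ℕ) : MulAction (Fin n → ℂˣ) (Grassmannian n) where
  smul t L := ⟨L.1.map (diagEquiv t).toLinearMap, by
    rw [LinearEquiv.finrank_map_eq]; exact L.2⟩
  one_smul L := by
    apply Subtype.ext
    change L.1.map (diagEquiv 1).toLinearMap = L.1
    have : (diagEquiv (1 : Fin n → ℂˣ)).toLinearMap = LinearMap.id := by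
      ext x i; simp
    rw [this, Submodule.map_id]
  mul_smul s t L := by
    apply Subtype.ext
    change L.1.map (diagEquiv (s * t)).toLinearMap =
      (L.1.map (diagEquiv t).toLinearMap).map (diagEquiv s).toLinearMap
    rw [← Submodule.map_comp]
    congr 1
    refine LinearMap.ext fun x => funext fun i => ?_
    simp [mul_assoc]

/-- The action of the compact torus `Tⁿ = (S¹)ⁿ` on `G_{n,2}`, the restriction of the action of
`(ℂ^*)ⁿ`. -/
instance (n : ℕ) : MulAction (Fin n → Circle) (Grassmannian n) :=
  MulAction.compHom (Grassmannian n)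
    (MonoidHom.pi fun i => Circle.toUnits.comp (Pi.evalMonoidHom (fun _ : Fin n => Circle) i))

/-- The orbit space `X_n = G_{n,2} / Tⁿ`. -/
abbrev OrbitSpace (n : ℕ) : Type :=
  MulAction.orbitRel.Quotient (Fin n → Circle) (Grassmannian n)

/-- The point `[L]` of `X_n`. -/
def toOrbit {n : ℕ} (L : Grassmannian n) : OrbitSpace n := Quotient.mk _ L

/-- The diagonal circle of `Tⁿ`. It acts trivially on `G_{n,2}`, and the torus which acts
effectively is `T^{n-1} = Tⁿ / S¹`. -/
def diagonalCircle (n : ℕ) : Subgroup (Fin n → Circle) :=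
  (Pi.constMonoidHom (Fin n) Circle).range

/-- A point of `X_n` is critical if the stabilizer of a point of its orbit in the effectively acting
torus `Tⁿ / S¹` is nontrivial, that is, if its stabilizer in `Tⁿ` is not just the diagonal circle.
(The torus is commutative, so the stabilizer is the same along an orbit.) -/
def IsCritical {n : ℕ} (x : OrbitSpace n) : Prop :=
  ∃ L : Grassmannian n, toOrbit L = x ∧
    MulAction.stabilizer (Fin n → Circle) L ≠ diagonalCircle n

/-! ## Strata and their spaces of parameters -/

/-- The condition `P^{ij}(L) ≠ 0` on a Plücker coordinate: some pair of vectors of `L` has a nonzero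
minor in the columns `i`, `j` (such a pair is a basis of `L`, and then all bases of `L` have this
property). -/
def PluckerNeZero {n : ℕ} (L : Grassmannian n) (i j : Fin n) : Prop :=
  ∃ u ∈ L.1, ∃ v ∈ L.1, u i * v j - u j * v i ≠ 0

/-- For a set `σ` of pairs `i < j`, the set `W_σ` of those planes whose Plücker coordinates
`P^{ij}`, `i < j`, are nonzero for `(i, j) ∈ σ` and zero for `(i, j) ∉ σ`. The nonempty sets of this
form are the strata. -/
def stratum {n : ℕ} (σ : Set (Fin n × Fin n)) : Set (Grassmannian n) :=
  {L | {e : Fin n × Fin n | e.1 < e.2 ∧ PluckerNeZero L e.1 e.2} = σ}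

/-- The index set of the main stratum: all pairs `i < j`. -/
def mainIndex (n : ℕ) : Set (Fin n × Fin n) := {e | e.1 < e.2}

/-- The orbit relation of `(ℂ^*)ⁿ` on the stratum `W_σ`. -/
def stratumSetoid {n : ℕ} (σ : Set (Fin n × Fin n)) : Setoid (stratum σ) :=
  (MulAction.orbitRel (Fin n → ℂˣ) (Grassmannian n)).comap Subtype.val

/-- The space of parameters `F_σ = W_σ / (ℂ^*)ⁿ`, with the quotient topology. -/
abbrev ParameterSpace {n : ℕ} (σ : Set (Fin n × Fin n)) : Type := Quotient (stratumSetoid σ)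

/-! ## The universal space of parameters, as seen from a Plücker chart -/

/-- The quotient topology on a complex projective space. -/
instance (V : Type*) [AddCommGroup V] [Module ℂ V] [TopologicalSpace V] :
    TopologicalSpace (ℙ ℂ V) :=
  inferInstanceAs (TopologicalSpace (Quotient (projectivizationSetoid ℂ V)))

/-- The pairs `p < q` of indices different from `a` and `b`. -/
abbrev Pairs (n : ℕ) (a b : Fin n) : Type :=
  {e : Fin n × Fin n // e.1 < e.2 ∧ e.1 ≠ a ∧ e.1 ≠ b ∧ e.2 ≠ a ∧ e.2 ≠ b}

/-- The product of `(n-2 choose 2)` copies of `ℂP¹` with coordinates `(c_{pq} : c'_{pq})`. -/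
abbrev ChartProduct (n : ℕ) (a b : Fin n) : Type := Pairs n a b → ℙ ℂ (Fin 2 → ℂ)

/-- `r` is a choice of homogeneous coordinates `(r₀, r₁) = (c_{pq}, c'_{pq})` of the point `c`. -/
def IsHomogeneousCoord {n : ℕ} {a b : Fin n} (r : Pairs n a b → Fin 2 → ℂ)
    (c : ChartProduct n a b) : Prop :=
  ∀ e, ∃ h : r e ≠ 0, c e = Projectivization.mk ℂ (r e) h

/-- `(z, w)` are the coordinates of `L` in the chart `M_{ab}`: the basis `z`, `w` of `L` whose
`2 × 2` block in the columns `a`, `b` is the identity matrix. -/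
def IsChartCoord {n : ℕ} (a b : Fin n) (L : Grassmannian n) (z w : Fin n → ℂ) : Prop :=
  z ∈ L.1 ∧ w ∈ L.1 ∧ z a = 1 ∧ z b = 0 ∧ w a = 0 ∧ w b = 1

/-- The equations `c'_{pq} z_p w_q = c_{pq} z_q w_p` for all `p < q` different from `a`, `b`. -/
def OrbitEquations {n : ℕ} {a b : Fin n} (z w : Fin n → ℂ) (c : ChartProduct n a b) : Prop :=
  ∃ r, IsHomogeneousCoord r c ∧
    ∀ e, r e 1 * (z e.1.1 * w e.1.2) = r e 0 * (z e.1.2 * w e.1.1)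

/-- The points of the product of projective lines which satisfy the equations given by the
coordinates, in the chart `M_{ab}`, of some point of the stratum `W_σ`. -/
def chartSolutions {n : ℕ} (σ : Set (Fin n × Fin n)) (a b : Fin n) : Set (ChartProduct n a b) :=
  {c | ∃ L ∈ stratum σ, ∃ z w, IsChartCoord a b L z w ∧ OrbitEquations z w c}

/-- The closure `F̄_n` in the product of projective lines of the space of parameters `F_n` of the
main stratum, embedded by `(c_{pq} : c'_{pq}) = (z_p w_q : z_q w_p)`. -/
def mainClosure (n : ℕ) (a b : Fin n) : Set (ChartProduct n a b) :=
  closure (chartSolutions (mainIndex n) a b)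

/-- The sets `S` of at least three indices different from `a`, `b`. They index the building set of
the wonderful compactification: the centre `F̄_S ⊂ F̄_n` is given by `(c_{pq} : c'_{pq}) = (1 : 1)`
for all `p, q ∈ S`. -/
abbrev CenterIndex (n : ℕ) (a b : Fin n) : Type :=
  {S : Finset (Fin n) // 3 ≤ S.card ∧ a ∉ S ∧ b ∉ S}

/-- Forms of multidegree `(1, …, 1)` generating the ideal sheaf of the centre `F̄_S`: the products of
`c_{pq} - c'_{pq}`, for `p, q ∈ S`, with all monomials which have degree one in each of the other
pairs of variables (`ε` chooses the variable; the coordinates with `{p, q} ⊄ S` are zero). -/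
def centerForms {n : ℕ} {a b : Fin n} (S : CenterIndex n a b) (r : Pairs n a b → Fin 2 → ℂ) :
    Pairs n a b × (Pairs n a b → Fin 2) → ℂ :=
  fun m => if m.1.1.1 ∈ S.1 ∧ m.1.1.2 ∈ S.1 then
    (r m.1 0 - r m.1 1) * ∏ f ∈ Finset.univ.erase m.1, r f (m.2 f) else 0

/-- The forms vanish simultaneously exactly on the centre. -/
theorem centerForms_ne_zero_iff {n : ℕ} {a b : Fin n} (S : CenterIndex n a b)
    (r : Pairs n a b → Fin 2 → ℂ) (hr : ∀ e, r e ≠ 0) :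
    centerForms S r ≠ 0 ↔ ∃ e : Pairs n a b, e.1.1 ∈ S.1 ∧ e.1.2 ∈ S.1 ∧ r e 0 ≠ r e 1 := by
  constructor
  · intro h
    obtain ⟨m, hm⟩ := Function.ne_iff.mp h
    by_cases hS : m.1.1.1 ∈ S.1 ∧ m.1.1.2 ∈ S.1
    · refine ⟨m.1, hS.1, hS.2, fun h0 => hm ?_⟩
      simp [centerForms, h0]
    · exact absurd (by simp only [centerForms, if_neg hS, Pi.zero_apply]) hm
  · rintro ⟨e, h1, h2, h3⟩
    have hε : ∀ f, ∃ k, r f k ≠ 0 := fun f => Function.ne_iff.mp (hr f)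
    choose ε hε using hε
    refine Function.ne_iff.mpr ⟨(e, ε), ?_⟩
    simp only [centerForms, h1, h2, and_self, if_true, Pi.zero_apply]
    exact mul_ne_zero (sub_ne_zero.mpr h3) (Finset.prod_ne_zero_iff.mpr fun f _ => hε f)

/-- The ambient space of the wonderful compactification: the product of projective lines which
contains `F̄_n` times, for each centre, the projective space which carries the exceptional coordinates
of the blow-up along this centre. -/
abbrev WonderfulAmbient (n : ℕ) (a b : Fin n) : Type :=
  ChartProduct n a b ×
    (CenterIndex n a b → ℙ ℂ (Pairs n a b × (Pairs n a b → Fin 2) → ℂ))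

/-- The complement in `F̄_n` of all centres `F̄_S`, embedded in the product of the blow-ups of `F̄_n`
along the centres (the blow-up of `F̄_n` along `F̄_S` being the closure of the graph of the map to
projective space given by `centerForms S`). -/
def wonderfulOpen (n : ℕ) (a b : Fin n) : Set (WonderfulAmbient n a b) :=
  {y | y.1 ∈ mainClosure n a b ∧ ∃ r, IsHomogeneousCoord r y.1 ∧
    ∀ S, ∃ h : centerForms S r ≠ 0, y.2 S = Projectivization.mk ℂ (centerForms S r) h}

/-- The universal space of parameters `𝓕_n`, in the record of the chart `M_{ab}`: the wonderful
compactification of `F̄_n` with the building set of all `F̄_S`, that is, the closure of the complement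
of the centres in the product of the blow-ups. -/
def universalSpace (n : ℕ) (a b : Fin n) : Set (WonderfulAmbient n a b) :=
  closure (wonderfulOpen n a b)

/-- The virtual space of parameters `F̃_{σ,ab} ⊂ 𝓕_n` of a stratum `W_σ ⊂ M_{ab}`: the points of `𝓕_n`
whose coordinates `(c_{pq} : c'_{pq})` satisfy the equations given by some point of `W_σ`. -/
def virtualSpace {n : ℕ} (σ : Set (Fin n × Fin n)) (a b : Fin n) : Set (WonderfulAmbient n a b) :=
  {y | y ∈ universalSpace n a b ∧ y.1 ∈ chartSolutions σ a b}

/-- A point `x` of `X_n` is singular if, for the stratum `W_σ` with `x ∈ W_σ / Tⁿ`, the space of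
parameters `F_σ` is not homeomorphic to the virtual space of parameters of `W_σ`, recorded in any
chart `M_{ij}` which contains `W_σ`. -/
def IsSingular {n : ℕ} (x : OrbitSpace n) : Prop :=
  ∀ σ : Set (Fin n × Fin n), (∃ L ∈ stratum σ, toOrbit L = x) →
    ∀ i j : Fin n, (i, j) ∈ σ → IsEmpty (ParameterSpace σ ≃ₜ virtualSpace σ i j)

end

end GrassmannOrbit

/-!
The proof compares dimensions. In a chart `M_{ab}` a plane is given by two vectors `z`, `w`, and its
class under the algebraic torus depends only on the slopes `w_q / z_q` which are finite and nonzero, up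
to a common factor. The point is critical only if some column of the plane vanishes
(`z_p = w_p = 0`), or if its columns have only the two directions `a` and `b`
(`exists_eq_zero_or_forall_mul_eq_zero`).

Points of the virtual space of parameters are obtained as limits, for `ε → 0`, of planes in the main
stratum with the slopes `ε ^ (k q) * (m q + ε * d q)`, where the `d q` are pairwise different. The limit
in the wonderful compactification exists and is explicit: if the slopes indexed by a centre `S` agree to
first order, then the exceptional coordinates are given by the differences of the `d q`, and otherwise
the limit in `F̄_n` is not on the centre (`limitPoint`, `limitPoint_mem_universalSpace`). The exponents
`k q` express which slopes degenerate to zero or infinity; wherever the equations of the plane leave a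
ratio of slopes undetermined, the corresponding `m q` are free (`limitPoint_mem_virtualSpace`).

If the columns have only two directions, then the space of parameters is a point, and the virtual space
of parameters has at least two points, as among three columns outside of the chart two can be given
slopes of the same order with an arbitrary ratio (`nontrivial_virtualSpace`).

Otherwise the normalized slopes embed the space of parameters into a finite-dimensional space `V`
(`exists_continuous_injective_slopeSpace`), where slopes of proportional columns are identified. The
virtual space of parameters contains the continuous injective image of an open subset of `V × ℂ`, since
the slope of the vanishing column is an additional free parameter
(`exists_continuous_injective_virtualSpace`). Hence a homeomorphism contradicts the invariance of
dimension (`finrank_le_of_continuousOn_injOn`).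

Invariance of dimension is derived from the surjectivity of compactly supported `C¹` perturbations
`id + g` of the identity (`surjective_add_of_hasCompactSupport`). For polynomial `q` and a ball `B`
outside of which `g` vanishes, the integral of `q(x + t g(x)) det(1 + t Dg(x))` over `B` is polynomial
in `t`, and it is constant for small `t` by the change of variables formula; so it has the same value
for `t = 1`, which fails for high powers of a quadratic function with its maximum at a point that is
missed by `id + g`.
-/

namespace GrassmannOrbit

open Filter Topology

noncomputable section

/-! ### Invariance of dimension -/

section Dimension

open MeasureTheory Metric Set

/-- Evaluation at `1` of polynomials of bounded degree is a fixed linear combination of evaluations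
at sufficiently many other nodes. -/
theorem exists_eval_one_eq_sum (s : Finset ℝ) :
    ∃ l : ℝ → ℝ, ∀ p : Polynomial ℝ, p.natDegree < s.card →
      p.eval 1 = ∑ t ∈ s, l t * p.eval t := by
  refine ⟨fun t => (Lagrange.basis s id t).eval 1, fun p hp => ?_⟩
  have h := Lagrange.eq_interpolate (s := s) (v := id) (f := p) (injOn_id _)
    (Polynomial.degree_le_natDegree.trans_lt (by exact_mod_cast hp))
  conv_lhs => rw [h]
  simp [Lagrange.interpolate_apply, Polynomial.eval_finsetSum, mul_comm]

section Brouwer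

variable {E : Type*} [NormedAddCommGroup E] [InnerProductSpace ℝ E] [FiniteDimensional ℝ E]

theorem exists_polynomial_det (A : E →L[ℝ] E) :
    ∃ p : Polynomial ℝ, p.natDegree ≤ Module.finrank ℝ E ∧
      ∀ t : ℝ, p.eval t = (ContinuousLinearMap.id ℝ E + t • A).det := by
  let b := Module.finBasis ℝ E
  let M := LinearMap.toMatrix b b (A : E →ₗ[ℝ] E)
  refine ⟨((Polynomial.X : Polynomial ℝ) • M.map Polynomial.C +
    (1 : Matrix _ _ ℝ).map Polynomial.C).det, ?_, fun t => ?_⟩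
  · simpa using Polynomial.natDegree_det_X_add_C_le M 1
  · rw [← Polynomial.coe_evalRingHom, RingHom.map_det]
    rw [ContinuousLinearMap.det, ← LinearMap.det_toMatrix b]
    congr 1
    have : ((ContinuousLinearMap.id ℝ E + t • A : E →L[ℝ] E) : E →ₗ[ℝ] E) =
      LinearMap.id + t • (A : E →ₗ[ℝ] E) := rfl
    have hM : LinearMap.toMatrix b b (LinearMap.id + t • (A : E →ₗ[ℝ] E)) = 1 + t • M := by
      rw [map_add, map_smul, LinearMap.toMatrix_id]
    rw [this, hM]
    ext i j
    simp [M, Matrix.one_apply, add_comm, apply_ite]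
    exact mul_comm _ _

/-- The integrand in the change of variables formula, for a power of the quadratic function
`1 - |y - c|² / M²`, is polynomial in the deformation parameter `t`. -/
theorem exists_polynomial_integrand (A : E →L[ℝ] E) (x v c : E) (M : ℝ) (s : ℕ) :
    ∃ p : Polynomial ℝ, p.natDegree < 2 * s + Module.finrank ℝ E + 1 ∧
      ∀ t : ℝ, p.eval t = (ContinuousLinearMap.id ℝ E + t • A).det *
        (1 - ‖x + t • v - c‖ ^ 2 / M ^ 2) ^ s := by
  obtain ⟨p, hp, hp'⟩ := exists_polynomial_det A
  let q : Polynomial ℝ := Polynomial.C (-(‖v‖ ^ 2 / M ^ 2)) * Polynomial.X ^ 2 +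
    Polynomial.C (-(2 * inner ℝ (x - c) v / M ^ 2)) * Polynomial.X +
    Polynomial.C (1 - ‖x - c‖ ^ 2 / M ^ 2)
  refine ⟨p * q ^ s, ?_, fun t => ?_⟩
  · have h1 : q.natDegree ≤ 2 := Polynomial.natDegree_quadratic_le
    have h2 : (q ^ s).natDegree ≤ s * 2 := Polynomial.natDegree_pow_le_of_le s h1
    have h3 := Polynomial.natDegree_mul_le (p := p) (q := q ^ s)
    omega
  · have h : ‖x + t • v - c‖ ^ 2 = ‖x - c‖ ^ 2 + 2 * (t * inner ℝ (x - c) v) + t ^ 2 * ‖v‖ ^ 2 := by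
      rw [show x + t • v - c = (x - c) + t • v by abel, norm_add_sq_real, inner_smul_right,
        norm_smul, mul_pow, Real.norm_eq_abs, sq_abs]
    rw [Polynomial.eval_mul, Polynomial.eval_pow, hp', h]
    congr 2
    simp only [q, Polynomial.eval_add, Polynomial.eval_mul, Polynomial.eval_C,
      Polynomial.eval_pow, Polynomial.eval_X]
    ring

/-- For small `t`, the map `x ↦ x + t g x` is a permutation of a ball outside of which `g`
vanishes. -/
theorem bijOn_closedBall_of_lipschitz {g : E → E} {K : NNReal} (hK : LipschitzWith K g) {c : E}
    {R : ℝ} (hR : ∀ x ∉ closedBall c R, g x = 0) {t : ℝ} (ht : |t| * K < 1) :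
    BijOn (fun x => x + t • g x) (closedBall c R) (closedBall c R) := by
  have hL : ApproximatesLinearOn (fun x => x + t • g x)
      ((ContinuousLinearEquiv.refl ℝ E : E ≃L[ℝ] E) : E →L[ℝ] E) univ (‖t‖₊ * K) := by
    intro x _ y _
    have := hK.norm_sub_le x y
    simp only [ContinuousLinearEquiv.coe_refl, ContinuousLinearMap.coe_id', id_eq]
    rw [show x + t • g x - (y + t • g y) - (x - y) = t • (g x - g y) by rw [smul_sub]; abel,
      norm_smul, NNReal.coe_mul, coe_nnnorm, mul_assoc]
    gcongr
  have hc : Subsingleton E ∨ ‖t‖₊ * K <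
      ‖(((ContinuousLinearEquiv.refl ℝ E).symm : E ≃L[ℝ] E) : E →L[ℝ] E)‖₊⁻¹ := by
    rcases subsingleton_or_nontrivial E with h | h
    · exact Or.inl h
    · right
      have h1 : ‖(((ContinuousLinearEquiv.refl ℝ E).symm : E ≃L[ℝ] E) : E →L[ℝ] E)‖₊ = 1 := by
        ext
        simp
      rw [h1, inv_one, ← NNReal.coe_lt_coe]
      simpa using ht
  have hinj : Function.Injective (fun x => x + t • g x) := by
    rw [← injOn_univ]
    exact hL.injOn hc
  have hsurj := hL.surjective hc
  have hout : ∀ x ∉ closedBall c R, x + t • g x = x := fun x hx => by simp [hR x hx]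
  refine ⟨fun x hx => ?_, hinj.injOn, fun y hy => ?_⟩
  · by_contra h
    have h1 : x + t • g x = x := hinj (hout _ h)
    exact h (by simpa only [h1] using hx)
  · obtain ⟨x, rfl⟩ := hsurj y
    refine ⟨x, ?_, rfl⟩
    by_contra h
    exact h (by simpa only [hout x h] using hy)

variable [MeasurableSpace E] [BorelSpace E]

/-- The change of variables formula for the maps `x ↦ x + t g x` with small `t`. -/
theorem integral_comp_add_smul_eq {g : E → E} (hg : ContDiff ℝ 1 g) {K : NNReal}
    (hK : LipschitzWith K g) {c : E} {R : ℝ} (hR : ∀ x ∉ closedBall c R, g x = 0) :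
    ∃ t₀ : ℝ, 0 < t₀ ∧ ∀ t ∈ Ioo 0 t₀, ∀ q : E → ℝ,
      ∫ x in closedBall c R, (ContinuousLinearMap.id ℝ E + t • fderiv ℝ g x).det *
        q (x + t • g x) = ∫ y in closedBall c R, q y := by
  -- Near the identity the determinant is positive.
  obtain ⟨δ, hδ, hdet⟩ : ∃ δ > 0, ∀ B : E →L[ℝ] E, ‖B‖ < δ →
      0 < (ContinuousLinearMap.id ℝ E + B).det := by
    have hcont : Continuous fun B : E →L[ℝ] E => (ContinuousLinearMap.id ℝ E + B).det :=
      ContinuousLinearMap.continuous_det.comp (continuous_const.add continuous_id)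
    have h0 : 0 < (ContinuousLinearMap.id ℝ E + (0 : E →L[ℝ] E)).det := by
      simp [ContinuousLinearMap.det]
    obtain ⟨δ, hδ, h⟩ := Metric.mem_nhds_iff.1
      (hcont.continuousAt.preimage_mem_nhds (Ioi_mem_nhds h0))
    exact ⟨δ, hδ, fun B hB => h (by simpa using hB)⟩
  refine ⟨min 1 δ / (K + 1), by positivity, fun t ht q => ?_⟩
  have ht1 : t * (K + 1) < min 1 δ := (lt_div_iff₀ (by positivity)).1 ht.2
  have htK : t * K < min 1 δ := by nlinarith [ht.1]
  have hbij := bijOn_closedBall_of_lipschitz hK hR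
    (t := t) (by rw [abs_of_pos ht.1]; exact htK.trans_le (min_le_left _ _))
  have key := integral_image_eq_integral_abs_det_fderiv_smul (volume : Measure E)
    (s := closedBall c R) (f := fun x => x + t • g x)
    (f' := fun x => ContinuousLinearMap.id ℝ E + t • fderiv ℝ g x)
    isClosed_closedBall.measurableSet
    (fun x _ => ((hasFDerivAt_id x).add
      (((hg.differentiable (by simp)) x).hasFDerivAt.const_smul t)).hasFDerivWithinAt)
    hbij.injOn q
  rw [hbij.image_eq] at key
  rw [key]
  refine integral_congr_ae (Eventually.of_forall fun x => ?_)
  simp only [smul_eq_mul]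
  rw [abs_of_pos]
  apply hdet
  rw [norm_smul, Real.norm_eq_abs, abs_of_pos ht.1]
  have := norm_fderiv_le_of_lipschitz ℝ hK (x₀ := x)
  calc t * ‖fderiv ℝ g x‖ ≤ t * K := by gcongr; exact ht.1.le
    _ < δ := htK.trans_le (min_le_right _ _)

/-- Both sides of the identity are polynomial in `t`, so that it persists from small `t` to
`t = 1`. -/
theorem integral_det_mul_pow_eq {g : E → E} (hg : ContDiff ℝ 1 g) {K : NNReal}
    (hK : LipschitzWith K g) {c : E} {R : ℝ} (hR : ∀ x ∉ closedBall c R, g x = 0) (M : ℝ) (s : ℕ) :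
    ∫ x in closedBall c R, (ContinuousLinearMap.id ℝ E + fderiv ℝ g x).det *
      (1 - ‖x + g x - c‖ ^ 2 / M ^ 2) ^ s =
    ∫ y in closedBall c R, (1 - ‖y - c‖ ^ 2 / M ^ 2) ^ s := by
  -- Express the value at `t = 1` through the values at sufficiently many small nodes.
  obtain ⟨t₀, ht₀, h⟩ := integral_comp_add_smul_eq hg hK hR
  obtain ⟨T, hT, hcard⟩ := (Ioo_infinite ht₀).exists_subset_card_eq
    (2 * s + Module.finrank ℝ E + 1)
  obtain ⟨l, hl⟩ := exists_eval_one_eq_sum T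
  have hsum : ∑ t ∈ T, l t = 1 := by
    have := hl 1 (by rw [hcard]; simp)
    simpa using this.symm
  have hpt : ∀ x, (ContinuousLinearMap.id ℝ E + fderiv ℝ g x).det *
      (1 - ‖x + g x - c‖ ^ 2 / M ^ 2) ^ s =
      ∑ t ∈ T, l t * ((ContinuousLinearMap.id ℝ E + t • fderiv ℝ g x).det *
        (1 - ‖x + t • g x - c‖ ^ 2 / M ^ 2) ^ s) := by
    intro x
    obtain ⟨p, hp, hp'⟩ := exists_polynomial_integrand (fderiv ℝ g x) x (g x) c M s
    have := hl p (hcard ▸ hp)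
    simp only [hp', one_smul] at this
    exact this
  have hgc := hg.continuous
  have hfc : Continuous (fderiv ℝ g) := hg.continuous_fderiv (by simp)
  simp only [hpt]
  rw [integral_finsetSum]
  · simp only [integral_const_mul]
    rw [Finset.sum_congr rfl fun t ht => by
      rw [h t (hT ht) (fun y => (1 - ‖y - c‖ ^ 2 / M ^ 2) ^ s)], ← Finset.sum_mul, hsum, one_mul]
  · intro t _
    apply ContinuousOn.integrableOn_compact (isCompact_closedBall c R)
    apply Continuous.continuousOn
    apply continuous_const.mul
    exact (ContinuousLinearMap.continuous_det.comp
      (continuous_const.add (hfc.const_smul t))).mul (by fun_prop)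

/-- A `C¹` perturbation of the identity with compact support is surjective. If it missed a
neighbourhood of `c`, then the powers of a quadratic function with maximum at `c` would have a smaller
exponential rate on its image than on a ball around `c`. -/
theorem surjective_add_of_hasCompactSupport {g : E → E} (hg : ContDiff ℝ 1 g)
    (hsupp : HasCompactSupport g) : Function.Surjective fun x => x + g x := by
  intro c
  by_contra hc
  push Not at hc
  obtain ⟨K, hK⟩ := hg.lipschitzWith_of_hasCompactSupport hsupp (by simp)
  obtain ⟨R, hR0, hsub⟩ : ∃ R, 0 < R ∧ tsupport g ⊆ closedBall c R := by
    obtain ⟨R, hR⟩ := hsupp.isCompact.isBounded.subset_closedBall c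
    exact ⟨max R 1, by positivity, hR.trans (closedBall_subset_closedBall (le_max_left _ _))⟩
  have hR : ∀ x ∉ closedBall c R, g x = 0 := fun x hx =>
    image_eq_zero_of_notMem_tsupport fun h => hx (hsub h)
  have hgc := hg.continuous
  have hfc : Continuous (fderiv ℝ g) := hg.continuous_fderiv (by simp)
  have hcomp : IsCompact (closedBall c R) := isCompact_closedBall c R
  have hne : (closedBall c R).Nonempty := ⟨c, mem_closedBall_self hR0.le⟩
  have hnc : Continuous fun x => ‖x + g x - c‖ := by fun_prop
  obtain ⟨x₀, -, hx₀⟩ := hcomp.exists_isMinOn hne hnc.continuousOn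
  obtain ⟨x₁, -, hx₁⟩ := hcomp.exists_isMaxOn hne hnc.continuousOn
  set δ := ‖x₀ + g x₀ - c‖ with hδ
  have hδ0 : 0 < δ := norm_pos_iff.2 (sub_ne_zero.2 (hc x₀))
  set M := max R ‖x₁ + g x₁ - c‖ with hM
  have hM0 : 0 < M := hR0.trans_le (le_max_left _ _)
  have hδM : δ ≤ M := (hx₀ (mem_closedBall_self hR0.le)).trans
    ((hx₁ (mem_closedBall_self hR0.le)).trans (le_max_right _ _))
  -- On the image of the ball, `1 - |y - c|² / M²` is at most `β`; on a ball around `c` whose radius is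
  -- smaller than `δ`, it is at least `α > β`.
  set β := 1 - δ ^ 2 / M ^ 2 with hβ
  set r := min R (δ / 2) with hr
  have hr0 : 0 < r := by positivity
  set α := 1 - r ^ 2 / M ^ 2 with hα
  have hrδ : r < δ := (min_le_right _ _).trans_lt (by linarith)
  have hβ0 : 0 ≤ β := by
    rw [hβ, sub_nonneg, div_le_one (by positivity)]
    gcongr
  have hβα : β < α := by
    rw [hβ, hα]
    gcongr
  have hα0 : 0 < α := hβ0.trans_lt hβα
  have hdc : Continuous fun x => (ContinuousLinearMap.id ℝ E + fderiv ℝ g x).det :=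
    ContinuousLinearMap.continuous_det.comp (continuous_const.add hfc)
  obtain ⟨C, hC⟩ := hcomp.exists_bound_of_continuousOn hdc.continuousOn
  have hC0 : 0 ≤ C := (norm_nonneg _).trans (hC c (mem_closedBall_self hR0.le))
  set V := (volume : Measure E).real (closedBall c R)
  set v := (volume : Measure E).real (closedBall c r)
  have hv0 : 0 < v := by
    refine ENNReal.toReal_pos ?_ (isCompact_closedBall c r).measure_lt_top.ne
    exact (measure_closedBall_pos _ _ hr0).ne'
  have hineq : ∀ s : ℕ, α ^ s * v ≤ C * β ^ s * V := by
    intro s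
    have hq : Continuous fun y : E => (1 - ‖y - c‖ ^ 2 / M ^ 2) ^ s := by fun_prop
    calc α ^ s * v = ∫ _ in closedBall c r, α ^ s := by
          rw [setIntegral_const, smul_eq_mul, mul_comm]
      _ ≤ ∫ y in closedBall c r, (1 - ‖y - c‖ ^ 2 / M ^ 2) ^ s := by
          apply setIntegral_mono_on
          · exact continuous_const.continuousOn.integrableOn_compact (isCompact_closedBall c r)
          · exact hq.continuousOn.integrableOn_compact (isCompact_closedBall c r)
          · exact isClosed_closedBall.measurableSet
          · intro y hy
            rw [mem_closedBall, dist_eq_norm] at hy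
            have : α ≤ 1 - ‖y - c‖ ^ 2 / M ^ 2 := by
              rw [hα]
              gcongr
            gcongr
      _ ≤ ∫ y in closedBall c R, (1 - ‖y - c‖ ^ 2 / M ^ 2) ^ s := by
          apply setIntegral_mono_set
          · exact hq.continuousOn.integrableOn_compact hcomp
          · filter_upwards [ae_restrict_mem isClosed_closedBall.measurableSet] with y hy
            rw [mem_closedBall, dist_eq_norm] at hy
            apply pow_nonneg
            rw [sub_nonneg, div_le_one (by positivity)]
            gcongr
            exact hy.trans (le_max_left _ _)
          · exact (closedBall_subset_closedBall (min_le_left _ _)).eventuallyLE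
      _ = ∫ x in closedBall c R, (ContinuousLinearMap.id ℝ E + fderiv ℝ g x).det *
            (1 - ‖x + g x - c‖ ^ 2 / M ^ 2) ^ s := (integral_det_mul_pow_eq hg hK hR M s).symm
      _ ≤ ∫ _ in closedBall c R, C * β ^ s := by
          apply setIntegral_mono_on
          · apply ContinuousOn.integrableOn_compact hcomp
            exact (hdc.mul (by fun_prop)).continuousOn
          · exact continuous_const.continuousOn.integrableOn_compact hcomp
          · exact isClosed_closedBall.measurableSet
          · intro x hx
            have h1 : δ ≤ ‖x + g x - c‖ := hx₀ hx
            have h2 : ‖x + g x - c‖ ≤ M := (hx₁ hx).trans (le_max_right _ _)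
            have h3 : 0 ≤ 1 - ‖x + g x - c‖ ^ 2 / M ^ 2 := by
              rw [sub_nonneg, div_le_one (by positivity)]
              gcongr
            have h4 : 1 - ‖x + g x - c‖ ^ 2 / M ^ 2 ≤ β := by
              rw [hβ]
              gcongr
            calc _ ≤ C * (1 - ‖x + g x - c‖ ^ 2 / M ^ 2) ^ s :=
                  mul_le_mul_of_nonneg_right ((le_abs_self _).trans (hC x hx)) (pow_nonneg h3 s)
              _ ≤ C * β ^ s := by gcongr
      _ = C * β ^ s * V := by
          rw [setIntegral_const, smul_eq_mul, mul_comm]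
  have hlim : Tendsto (fun s : ℕ => C * V * (β / α) ^ s) atTop (𝓝 (C * V * 0)) :=
    (tendsto_pow_atTop_nhds_zero_of_lt_one (by positivity)
      ((div_lt_one hα0).2 hβα)).const_mul _
  rw [mul_zero] at hlim
  obtain ⟨s, hs⟩ := (hlim.eventually (gt_mem_nhds hv0)).exists
  have h1 := hineq s
  have h2 : C * V * (β / α) ^ s * α ^ s = C * β ^ s * V := by
    rw [div_pow]
    field_simp
  have h3 : 0 < α ^ s := by positivity
  nlinarith

/-- A continuous map which moves the points of a ball by less than its radius attains the centre of
the ball. -/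
theorem exists_eq_center_of_norm_sub_le {φ : E → E} (hφ : Continuous φ) {c : E} {R ε : ℝ}
    (hε : 0 ≤ ε) (hεR : ε < R) (h : ∀ x ∈ closedBall c R, ‖φ x - x‖ ≤ ε) :
    ∃ x ∈ closedBall c R, φ x = c := by
  by_contra hc
  push Not at hc
  have hR0 : 0 < R := hε.trans_lt hεR
  obtain ⟨x₀, hx₀m, hx₀⟩ := (isCompact_closedBall c R).exists_isMinOn
    ⟨c, mem_closedBall_self hR0.le⟩ (f := fun x => ‖φ x - c‖) (by fun_prop)
  have hδ : 0 < ‖φ x₀ - c‖ := norm_pos_iff.2 (sub_ne_zero.2 (hc x₀ hx₀m))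
  set δ := min ‖φ x₀ - c‖ ((R - ε) / 2) with hδd
  have hδ0 : 0 < δ := lt_min hδ (by linarith)
  obtain ⟨ψ, hψ, hψφ, -⟩ := hφ.exists_contDiff_approx 1 (ε := fun _ => δ) continuous_const
    fun _ => hδ0
  have hδR : ε + δ < R := by
    have := min_le_right ‖φ x₀ - c‖ ((R - ε) / 2)
    linarith
  -- Cut off the perturbation `ψ - id` near the boundary of the ball, where it cannot reach `c`.
  let χ : ContDiffBump c := ⟨ε + δ, R, by linarith, hδR⟩
  have hg : ContDiff ℝ 1 fun x => χ x • (ψ x - x) := χ.contDiff.smul (hψ.sub contDiff_id)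
  obtain ⟨x, hx⟩ := surjective_add_of_hasCompactSupport hg χ.hasCompactSupport.smul_right c
  simp only at hx
  have hψx := hψφ x
  rw [dist_eq_norm] at hψx
  by_cases h1 : x ∈ closedBall c (ε + δ)
  · rw [χ.one_of_mem_closedBall h1, one_smul, add_sub_cancel] at hx
    have h2 := hx₀ (closedBall_subset_closedBall hδR.le h1)
    rw [hx, norm_sub_rev] at hψx
    exact (hψx.trans_le (min_le_left _ _)).not_ge h2
  · rw [mem_closedBall, dist_eq_norm, not_le] at h1
    by_cases h2 : x ∈ closedBall c R
    · have h3 : ‖x - c‖ = ‖χ x • (ψ x - x)‖ := by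
        rw [← norm_neg, neg_sub, ← add_sub_cancel_left x (χ x • (ψ x - x)), hx]
      rw [norm_smul, Real.norm_eq_abs, abs_of_nonneg χ.nonneg] at h3
      have h4 : ‖ψ x - x‖ ≤ δ + ε := by
        rw [show ψ x - x = (ψ x - φ x) + (φ x - x) by abel]
        exact (norm_add_le _ _).trans (add_le_add hψx.le (h x h2))
      have h5 := mul_le_of_le_one_left (norm_nonneg (ψ x - x)) (χ.le_one (x := x))
      linarith
    · have h3 : χ x = 0 := χ.zero_of_le_dist (not_le.1 h2).le
      rw [h3, zero_smul, add_zero] at hx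
      exact h2 (hx ▸ mem_closedBall_self hR0.le)

end Brouwer

/-- On a closed ball, `f` has a continuous inverse. A `C¹` approximation to this inverse misses a point
near the centre if the source of the inverse has smaller dimension, while its composition with `f` is
close to the identity. -/
theorem finrank_le_of_continuousOn_injOn_euclidean {d e : ℕ} {U : Set (EuclideanSpace ℝ (Fin d))}
    (hU : IsOpen U) (hne : U.Nonempty)
    {f : EuclideanSpace ℝ (Fin d) → EuclideanSpace ℝ (Fin e)}
    (hf : ContinuousOn f U) (hinj : InjOn f U) : d ≤ e := by
  by_contra! hlt
  obtain ⟨c, hc⟩ := hne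
  obtain ⟨R, hR, hball⟩ := Metric.nhds_basis_closedBall.mem_iff.1 (hU.mem_nhds hc)
  let B := closedBall c R
  have : CompactSpace B := isCompact_iff_compactSpace.1 (isCompact_closedBall c R)
  have hfB : Continuous fun x : B => f x := (hf.mono hball).domRestrict
  have hemb : IsClosedEmbedding fun x : B => f x :=
    hfB.isClosedEmbedding fun x y hxy => Subtype.ext (hinj (hball x.2) (hball y.2) hxy)
  -- Extend the inverse of `f` on the ball, and `f` itself, to the whole spaces.
  obtain ⟨G, hG⟩ := ContinuousMap.exists_extension (X₁ := B) hemb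
    (⟨fun x => (x : EuclideanSpace ℝ (Fin d)), continuous_subtype_val⟩ : C(B, _))
  obtain ⟨f', hf'⟩ := ContinuousMap.exists_restrict_eq (isClosed_closedBall (x := c) (ε := R))
    (⟨fun x => f x, hfB⟩ : C(B, _))
  obtain ⟨H, hH, hHG, -⟩ := G.continuous.exists_contDiff_approx 1 (ε := fun _ => R / 4)
    continuous_const fun _ => by positivity
  obtain ⟨c', hc', hc'B⟩ := (hH.dense_compl_range_of_finrank_lt_finrank
    (by simpa using hlt)).exists_mem_open isOpen_ball ⟨c, mem_ball_self (x := c) (half_pos hR)⟩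
  have hsub : closedBall c' (R / 2) ⊆ closedBall c R := by
    apply closedBall_subset_closedBall'
    have := mem_ball.1 hc'B
    linarith
  obtain ⟨x, hx, hxc⟩ := exists_eq_center_of_norm_sub_le (φ := fun x => H (f' x))
    (hH.continuous.comp f'.continuous) (c := c') (R := R / 2) (ε := R / 4)
    (by positivity) (by linarith) (fun x hx => by
      have h1 : f' x = f x := congrArg (fun h : C(B, _) => h ⟨x, hsub hx⟩) hf'
      have h2 : G (f x) = x := congrArg (fun h : C(B, _) => h ⟨x, hsub hx⟩) hG
      have h3 := (hHG (f x)).le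
      rwa [h2, dist_eq_norm, ← h1] at h3)
  exact hc' ⟨_, hxc⟩

/-- Invariance of dimension: a nonempty open set does not embed continuously into a space of smaller
dimension. -/
theorem finrank_le_of_continuousOn_injOn {E F : Type*} [NormedAddCommGroup E] [NormedSpace ℝ E]
    [FiniteDimensional ℝ E] [NormedAddCommGroup F] [NormedSpace ℝ F] [FiniteDimensional ℝ F]
    {U : Set E} (hU : IsOpen U) (hne : U.Nonempty) {f : E → F} (hf : ContinuousOn f U)
    (hinj : InjOn f U) : Module.finrank ℝ E ≤ Module.finrank ℝ F := by
  let eE := toEuclidean (E := E)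
  let eF := toEuclidean (E := F)
  refine finrank_le_of_continuousOn_injOn_euclidean (U := eE.symm ⁻¹' U)
    (f := fun x => eF (f (eE.symm x))) (hU.preimage eE.symm.continuous) ?_ ?_ ?_
  · obtain ⟨x, hx⟩ := hne
    exact ⟨eE x, by simpa using hx⟩
  · exact eF.continuous.comp_continuousOn
      (hf.comp eE.symm.continuous.continuousOn fun x hx => hx)
  · intro x hx y hy hxy
    exact eE.symm.injective (hinj hx hy (eF.injective hxy))

end Dimension

/-! ### Continuity of maps into projective spaces -/

section Projective

variable {V : Type*} [AddCommGroup V] [Module ℂ V]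

theorem continuous_projectivization_mk [TopologicalSpace V] {X : Type*} [TopologicalSpace X] {f : X → V}
    (hf : Continuous f) (h : ∀ x, f x ≠ 0) :
    Continuous fun x => Projectivization.mk ℂ (f x) (h x) :=
  (continuous_quotient_mk' (s := projectivizationSetoid ℂ V)).comp
    (Continuous.subtype_mk hf h)

open Classical in
/-- The class of a vector in the projective space, with the value `x₀` at the zero vector. -/
def projClass (x₀ : ℙ ℂ V) (v : V) : ℙ ℂ V :=
  if h : v ≠ 0 then Projectivization.mk ℂ v h else x₀

theorem projClass_of_ne (x₀ : ℙ ℂ V) {v : V} (h : v ≠ 0) :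
    projClass x₀ v = Projectivization.mk ℂ v h := dif_pos h

theorem continuousAt_projClass [TopologicalSpace V] [T1Space V] (x₀ : ℙ ℂ V) {v : V} (h : v ≠ 0) :
    ContinuousAt (projClass x₀) v := by
  have ho : IsOpen {v : V | v ≠ 0} := isOpen_ne
  refine ContinuousOn.continuousAt ?_ (ho.mem_nhds h)
  rw [continuousOn_iff_continuous_domRestrict]
  refine (continuous_projectivization_mk (f := fun v : {v : V | v ≠ 0} => (v : V))
    continuous_subtype_val fun v => v.2).congr fun v => ?_
  exact (projClass_of_ne x₀ v.2).symm

end Projective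

/-! ### Limit points in the universal space of parameters -/

variable {n : ℕ} {a b : Fin n}

/-- Homogeneous coordinates `(y_q : y_p)` for `y_q = ε ^ (k q) * u q`, from which the common power
of `ε` has been removed (the subtraction is truncated), so that they make sense for `ε = 0`. -/
def slopeCoord (k : Fin n → ℕ) (u : Fin n → ℂ) (ε : ℂ) (e : Pairs n a b) : Fin 2 → ℂ :=
  ![ε ^ (k e.1.2 - k e.1.1) * u e.1.2, ε ^ (k e.1.1 - k e.1.2) * u e.1.1]

theorem slopeCoord_ne_zero (k : Fin n → ℕ) {u : Fin n → ℂ} (hu : ∀ q, u q ≠ 0) (ε : ℂ)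
    (e : Pairs n a b) : slopeCoord k u ε e ≠ 0 := by
  intro h
  have h0 := congrFun h 0
  have h1 := congrFun h 1
  simp only [slopeCoord, Matrix.cons_val_zero, Matrix.cons_val_one, Pi.zero_apply, mul_eq_zero,
    hu, or_false] at h0 h1
  rcases le_total (k e.1.1) (k e.1.2) with h2 | h2
  · rw [Nat.sub_eq_zero_of_le h2] at h1
    simp at h1
  · rw [Nat.sub_eq_zero_of_le h2] at h0
    simp at h0

theorem continuous_slopeCoord {X : Type*} [TopologicalSpace X] (k : Fin n → ℕ)
    {u : X → Fin n → ℂ} (hu : Continuous u) {ε : X → ℂ} (hε : Continuous ε) (e : Pairs n a b) :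
    Continuous fun x => slopeCoord k (u x) (ε x) e := by
  have h := continuous_pi_iff.1 hu
  refine continuous_pi fun i => ?_
  fin_cases i
  · exact (hε.pow _).mul (h _)
  · exact (hε.pow _).mul (h _)

theorem slopeCoord_zero_eq_iff (k : Fin n → ℕ) {m : Fin n → ℂ} (hm : ∀ q, m q ≠ 0)
    (e : Pairs n a b) : slopeCoord k m 0 e 0 = slopeCoord k m 0 e 1 ↔
      k e.1.1 = k e.1.2 ∧ m e.1.1 = m e.1.2 := by
  simp only [slopeCoord, Matrix.cons_val_zero, Matrix.cons_val_one]
  rcases lt_trichotomy (k e.1.1) (k e.1.2) with h | h | h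
  · rw [Nat.sub_eq_zero_of_le h.le, zero_pow (Nat.sub_ne_zero_of_lt h)]
    simp [h.ne, (hm _).symm]
  · simp [h, eq_comm]
  · rw [Nat.sub_eq_zero_of_le h.le, zero_pow (Nat.sub_ne_zero_of_lt h)]
    simp [h.ne', hm]

/-- The forms `centerForms` with arbitrary values `δ` in place of the differences
`c_{pq} - c'_{pq}`. -/
def twistedForms (S : CenterIndex n a b) (δ : Pairs n a b → ℂ) (r : Pairs n a b → Fin 2 → ℂ) :
    Pairs n a b × (Pairs n a b → Fin 2) → ℂ :=
  fun m => if m.1.1.1 ∈ S.1 ∧ m.1.1.2 ∈ S.1 then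
    δ m.1 * ∏ f ∈ Finset.univ.erase m.1, r f (m.2 f) else 0

theorem centerForms_eq_twistedForms (S : CenterIndex n a b) (r : Pairs n a b → Fin 2 → ℂ) :
    centerForms S r = twistedForms S (fun e => r e 0 - r e 1) r := rfl

theorem twistedForms_smul (S : CenterIndex n a b) (t : ℂ) (δ : Pairs n a b → ℂ)
    (r : Pairs n a b → Fin 2 → ℂ) : twistedForms S (fun e => t * δ e) r = t • twistedForms S δ r := by
  funext m
  simp only [twistedForms, Pi.smul_apply, smul_eq_mul, mul_ite, mul_zero, mul_assoc]

theorem twistedForms_ne_zero {S : CenterIndex n a b} {δ : Pairs n a b → ℂ}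
    {r : Pairs n a b → Fin 2 → ℂ} (hr : ∀ e, r e ≠ 0) {e : Pairs n a b} (h1 : e.1.1 ∈ S.1)
    (h2 : e.1.2 ∈ S.1) (hδ : δ e ≠ 0) : twistedForms S δ r ≠ 0 := by
  have hε : ∀ f, ∃ k, r f k ≠ 0 := fun f => Function.ne_iff.mp (hr f)
  choose ε hε using hε
  refine Function.ne_iff.mpr ⟨(e, ε), ?_⟩
  simp only [twistedForms, h1, h2, and_self, if_true, Pi.zero_apply]
  exact mul_ne_zero hδ (Finset.prod_ne_zero_iff.mpr fun f _ => hε f)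

theorem continuous_twistedForms {X : Type*} [TopologicalSpace X] (S : CenterIndex n a b)
    {δ : X → Pairs n a b → ℂ} (hδ : ∀ e, Continuous fun x => δ x e)
    {r : X → Pairs n a b → Fin 2 → ℂ} (hr : ∀ e, Continuous fun x => r x e) :
    Continuous fun x => twistedForms S (δ x) (r x) := by
  refine continuous_pi fun m => ?_
  simp only [twistedForms]
  split_ifs
  · exact (hδ _).mul (continuous_finsetProd _ fun f _ => (continuous_pi_iff.1 (hr f)) _)
  · exact continuous_const

/-- The slopes `ε ^ (k q) * (m q + ε * d q)`, for `q ∈ S`, agree to first order as `ε → 0`. -/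
def IsCoincident (k : Fin n → ℕ) (m : Fin n → ℂ) (S : CenterIndex n a b) : Prop :=
  ∀ p ∈ S.1, ∀ q ∈ S.1, k p = k q ∧ m p = m q

open Classical in
/-- The differences of the homogeneous coordinates of the slopes `ε ^ (k q) * (m q + ε * d q)`,
divided by `ε` if all the slopes indexed by `S` agree to first order. -/
def slopeDiff (k : Fin n → ℕ) (m d : Fin n → ℂ) (S : CenterIndex n a b) (ε : ℂ)
    (e : Pairs n a b) : ℂ :=
  if IsCoincident k m S then d e.1.2 - d e.1.1
  else slopeCoord k (m + ε • d) ε e 0 - slopeCoord k (m + ε • d) ε e 1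

theorem CenterIndex.exists_pair (S : CenterIndex n a b) {P : Fin n → Fin n → Prop}
    (hP : ∃ p ∈ S.1, ∃ q ∈ S.1, p ≠ q ∧ P p q) (hsymm : ∀ p q, P p q → P q p) :
    ∃ e : Pairs n a b, e.1.1 ∈ S.1 ∧ e.1.2 ∈ S.1 ∧ P e.1.1 e.1.2 := by
  obtain ⟨p, hp, q, hq, hpq, h⟩ := hP
  have hne : ∀ x ∈ S.1, x ≠ a ∧ x ≠ b := fun x hx =>
    ⟨fun h => S.2.2.1 (h ▸ hx), fun h => S.2.2.2 (h ▸ hx)⟩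
  rcases lt_or_gt_of_ne hpq with hlt | hlt
  · exact ⟨⟨(p, q), hlt, (hne p hp).1, (hne p hp).2, (hne q hq).1, (hne q hq).2⟩, hp, hq, h⟩
  · exact ⟨⟨(q, p), hlt, (hne q hq).1, (hne q hq).2, (hne p hp).1, (hne p hp).2⟩, hq, hp,
      hsymm _ _ h⟩

theorem CenterIndex.exists_ne (S : CenterIndex n a b) : ∃ p ∈ S.1, ∃ q ∈ S.1, p ≠ q :=
  let ⟨p, hp, q, hq, h⟩ := Finset.one_lt_card.1 (lt_of_lt_of_le (by norm_num) S.2.1)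
  ⟨p, hp, q, hq, h⟩

theorem twistedForms_slopeDiff_ne_zero (k : Fin n → ℕ) {m d : Fin n → ℂ} (hm : ∀ q, m q ≠ 0)
    (hd : Function.Injective d) (S : CenterIndex n a b) :
    twistedForms S (slopeDiff k m d S 0) (slopeCoord k m 0) ≠ 0 := by
  by_cases hS : IsCoincident k m S
  · obtain ⟨p, hp, q, hq, hpq⟩ := S.exists_ne
    obtain ⟨e, h1, h2, h3⟩ := S.exists_pair (P := fun p q => p ≠ q) ⟨p, hp, q, hq, hpq, hpq⟩
      fun _ _ => Ne.symm
    refine twistedForms_ne_zero (slopeCoord_ne_zero k hm 0) h1 h2 ?_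
    rw [slopeDiff, if_pos hS]
    exact sub_ne_zero.2 (hd.ne h3.symm)
  · have hS' := hS
    simp only [IsCoincident, not_forall] at hS
    obtain ⟨p, hp, q, hq, h⟩ := hS
    obtain ⟨e, h1, h2, h3⟩ := S.exists_pair (P := fun p q => ¬(k p = k q ∧ m p = m q))
      ⟨p, hp, q, hq, fun hpq => h (by rw [hpq]; exact ⟨rfl, rfl⟩), h⟩
      fun p q h h' => h ⟨h'.1.symm, h'.2.symm⟩
    refine twistedForms_ne_zero (slopeCoord_ne_zero k hm 0) h1 h2 ?_
    rw [slopeDiff, if_neg hS', zero_smul, add_zero, sub_ne_zero]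
    exact fun h => h3 ((slopeCoord_zero_eq_iff k hm e).1 h)

/-- The limit, as `ε → 0`, of the points of the wonderful compactification given by the planes with
slopes `w_q / z_q = ε ^ (k q) * (m q + ε * d q)`. -/
def limitPoint (a b : Fin n) (k : Fin n → ℕ) {m d : Fin n → ℂ} (hm : ∀ q, m q ≠ 0)
    (hd : Function.Injective d) : WonderfulAmbient n a b :=
  (fun e => Projectivization.mk ℂ (slopeCoord k m 0 e) (slopeCoord_ne_zero k hm 0 e),
    fun S => Projectivization.mk ℂ (twistedForms S (slopeDiff k m d S 0) (slopeCoord k m 0))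
      (twistedForms_slopeDiff_ne_zero k hm hd S))

theorem continuous_limitPoint {X : Type*} [TopologicalSpace X] (k : Fin n → ℕ) {m : X → Fin n → ℂ}
    {d : Fin n → ℂ} (hmc : Continuous m) (hm : ∀ x q, m x q ≠ 0) (hd : Function.Injective d)
    (hcoin : ∀ x y p q, k p = k q → m x p = m x q → m y p = m y q) :
    Continuous fun x => limitPoint a b k (hm x) hd := by
  have hr := fun e : Pairs n a b =>
    continuous_slopeCoord k hmc (continuous_const (y := (0 : ℂ))) e
  refine Continuous.prodMk (continuous_pi fun e => ?_) (continuous_pi fun S => ?_)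
  · exact continuous_projectivization_mk (hr e) _
  · refine continuous_projectivization_mk (continuous_twistedForms S (fun e => ?_) hr) _
    by_cases hS : ∃ x, IsCoincident k (m x) S
    · obtain ⟨x, hx⟩ := hS
      have : ∀ y, IsCoincident k (m y) S := fun y p hp q hq =>
        ⟨(hx p hp q hq).1, hcoin x y p q (hx p hp q hq).1 (hx p hp q hq).2⟩
      simp only [slopeDiff, this, if_true]
      exact continuous_const
    · push Not at hS
      simp only [slopeDiff, hS, if_false, zero_smul, add_zero]
      exact ((continuous_pi_iff.1 (hr e)) 0).sub ((continuous_pi_iff.1 (hr e)) 1)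

theorem eq_of_limitPoint_eq {k : Fin n → ℕ} {m m' d : Fin n → ℂ} (hm : ∀ q, m q ≠ 0)
    (hm' : ∀ q, m' q ≠ 0) (hd : Function.Injective d)
    (h : limitPoint a b k hm hd = limitPoint a b k hm' hd) {p q : Fin n} (hpq : p ≠ q)
    (hpa : p ≠ a) (hpb : p ≠ b) (hqa : q ≠ a) (hqb : q ≠ b) (hk : k p = k q) :
    m p * m' q = m q * m' p := by
  wlog hlt : p < q generalizing p q
  · exact (this hpq.symm hqa hqb hpa hpb hk.symm (lt_of_le_of_ne (not_lt.1 hlt) hpq.symm)).symm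
  have h1 := congrFun (congrArg Prod.fst h) ⟨(p, q), hlt, hpa, hpb, hqa, hqb⟩
  simp only [limitPoint] at h1
  rw [Projectivization.mk_eq_mk_iff'] at h1
  obtain ⟨t, ht⟩ := h1
  have h2 := congrFun ht 0
  have h3 := congrFun ht 1
  simp only [slopeCoord, hk, Matrix.cons_val_zero, Matrix.cons_val_one, Pi.smul_apply,
    smul_eq_mul, Nat.sub_self, pow_zero, one_mul] at h2 h3
  rw [← h2, ← h3]
  ring

/-! ### Planes with given chart coordinates -/

/-- The plane spanned by `z`, `w`. -/
def planeOf {a b : Fin n} {z w : Fin n → ℂ} (hza : z a = 1) (hzb : z b = 0) (hwa : w a = 0)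
    (hwb : w b = 1) : Grassmannian n :=
  Frame.plane ⟨![z, w], by
    rw [LinearIndependent.pair_iff]
    intro s t h
    have h1 := congrFun h a
    have h2 := congrFun h b
    simp only [Pi.add_apply, Pi.smul_apply, smul_eq_mul, hza, hzb, hwa, hwb, mul_one, mul_zero,
      add_zero, zero_add, Pi.zero_apply] at h1 h2
    exact ⟨h1, h2⟩⟩

theorem pluckerNeZero_plane_iff (v : Frame n) (i j : Fin n) :
    PluckerNeZero v.plane i j ↔ v.1 0 i * v.1 1 j - v.1 1 i * v.1 0 j ≠ 0 := by
  have hmem : ∀ x, x ∈ v.plane.1 ↔ ∃ s t : ℂ, s • v.1 0 + t • v.1 1 = x := by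
    intro x
    have hr : Set.range v.1 = {v.1 0, v.1 1} := by
      ext y; simp [Fin.exists_fin_two, eq_comm]
    change x ∈ Submodule.span ℂ (Set.range v.1) ↔ _
    rw [hr, Submodule.mem_span_pair]
  constructor
  · rintro ⟨x, hx, y, hy, h⟩ h0
    obtain ⟨s, t, rfl⟩ := (hmem x).1 hx
    obtain ⟨s', t', rfl⟩ := (hmem y).1 hy
    apply h
    simp only [Pi.add_apply, Pi.smul_apply, smul_eq_mul]
    linear_combination (s * t' - t * s') * h0
  · intro h
    exact ⟨v.1 0, (hmem _).2 ⟨1, 0, by simp⟩, v.1 1, (hmem _).2 ⟨0, 1, by simp⟩,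
      by rwa [mul_comm (v.1 0 j)]⟩

theorem isChartCoord_planeOf {z w : Fin n → ℂ} (hza : z a = 1) (hzb : z b = 0) (hwa : w a = 0)
    (hwb : w b = 1) : IsChartCoord a b (planeOf hza hzb hwa hwb) z w :=
  ⟨Submodule.subset_span ⟨0, rfl⟩, Submodule.subset_span ⟨1, rfl⟩, hza, hzb, hwa, hwb⟩

theorem pluckerNeZero_planeOf_iff {z w : Fin n → ℂ} (hza : z a = 1) (hzb : z b = 0) (hwa : w a = 0)
    (hwb : w b = 1) (i j : Fin n) :
    PluckerNeZero (planeOf hza hzb hwa hwb) i j ↔ z i * w j - w i * z j ≠ 0 :=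
  pluckerNeZero_plane_iff _ i j

/-- For `ε ≠ 0`, homogeneous coordinates with distinct entries are those of a plane in the main stratum,
the one with slopes `w_q / z_q = ε ^ (k q) * u q`. -/
theorem mem_chartSolutions_main (hab : a ≠ b) (k : Fin n → ℕ) {u : Fin n → ℂ} {ε : ℂ}
    (hε : ε ≠ 0) (hu : ∀ q, u q ≠ 0)
    (hne : ∀ e : Pairs n a b, slopeCoord k u ε e 0 ≠ slopeCoord k u ε e 1) {c : ChartProduct n a b}
    (hc : IsHomogeneousCoord (slopeCoord k u ε) c) : c ∈ chartSolutions (mainIndex n) a b := by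
  let z : Fin n → ℂ := fun q => if q = b then 0 else 1
  let w : Fin n → ℂ := fun q => if q = a then 0 else if q = b then 1 else ε ^ k q * u q
  have hza : z a = 1 := by simp [z, hab]
  have hzb : z b = 0 := by simp [z]
  have hwa : w a = 0 := by simp [w]
  have hwb : w b = 1 := by simp [w, hab.symm]
  have hz : ∀ q, q ≠ b → z q = 1 := fun q hq => by simp [z, hq]
  have hw : ∀ q, q ≠ a → q ≠ b → w q = ε ^ k q * u q := fun q hq hq' => by simp [w, hq, hq']
  have hw0 : ∀ q, q ≠ a → w q ≠ 0 := fun q hq => by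
    by_cases hqb : q = b
    · rw [hqb, hwb]; exact one_ne_zero
    · rw [hw q hq hqb]; exact mul_ne_zero (pow_ne_zero _ hε) (hu q)
  -- Clearing the common power of `ε` identifies the slopes with their homogeneous coordinates.
  have hs0 : ∀ e : Pairs n a b, ε ^ (min (k e.1.1) (k e.1.2)) * slopeCoord k u ε e 0 = w e.1.2 := by
    intro e
    rw [hw _ e.2.2.2.2.1 e.2.2.2.2.2]
    change _ * (ε ^ (k e.1.2 - k e.1.1) * u e.1.2) = _
    rw [← mul_assoc, ← pow_add]
    congr 2
    omega
  have hs1 : ∀ e : Pairs n a b, ε ^ (min (k e.1.1) (k e.1.2)) * slopeCoord k u ε e 1 = w e.1.1 := by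
    intro e
    rw [hw _ e.2.2.1 e.2.2.2.1]
    change _ * (ε ^ (k e.1.1 - k e.1.2) * u e.1.1) = _
    rw [← mul_assoc, ← pow_add]
    congr 2
    omega
  refine ⟨planeOf hza hzb hwa hwb, ?_, z, w, isChartCoord_planeOf hza hzb hwa hwb, _, hc, ?_⟩
  · ext ⟨i, j⟩
    simp only [Set.mem_ofPred_eq, mainIndex, and_iff_left_iff_imp, pluckerNeZero_planeOf_iff]
    intro hij
    by_cases hib : i = b
    · subst hib
      rw [hzb, hz j hij.ne', hwb]
      simp
    by_cases hjb : j = b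
    · subst hjb
      rw [hzb, hz i hib, hwb]
      simp
    by_cases hia : i = a
    · subst hia
      simpa [hza, hwa] using hw0 j hij.ne'
    by_cases hja : j = a
    · subst hja
      simpa [hza, hwa] using hw0 i hia
    rw [hz i hib, hz j hjb, one_mul, mul_one, sub_ne_zero]
    intro h
    let e : Pairs n a b := ⟨(i, j), hij, hia, hib, hja, hjb⟩
    refine hne e ?_
    have h0 := hs0 e
    have h1 := hs1 e
    rw [show w e.1.2 = w e.1.1 from h, ← h1] at h0
    exact mul_left_cancel₀ (pow_ne_zero _ hε) h0
  · intro e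
    rw [hz _ e.2.2.2.1, hz _ e.2.2.2.2.2, ← hs0 e, ← hs1 e]
    ring

/-! ### Limit points lie in the universal space of parameters -/

theorem limitPoint_mem_universalSpace (hab : a ≠ b) (k : Fin n → ℕ) {m d : Fin n → ℂ}
    (hm : ∀ q, m q ≠ 0) (hd : Function.Injective d) :
    limitPoint a b k hm hd ∈ universalSpace n a b := by
  let u : ℂ → Fin n → ℂ := fun ε => m + ε • d
  have huc : Continuous u := by fun_prop
  have hu0 : u 0 = m := by simp [u]
  have hr : ∀ e : Pairs n a b, Continuous fun ε => slopeCoord k (u ε) ε e :=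
    fun e => continuous_slopeCoord k huc continuous_id e
  have hδ : ∀ (S : CenterIndex n a b) e, Continuous fun ε => slopeDiff k m d S ε e := by
    intro S e
    simp only [slopeDiff]
    split_ifs
    · exact continuous_const
    · exact ((continuous_pi_iff.1 (hr e)) 0).sub ((continuous_pi_iff.1 (hr e)) 1)
  let Y : ℂ → WonderfulAmbient n a b := fun ε =>
    (fun e => projClass ((limitPoint a b k hm hd).1 e) (slopeCoord k (u ε) ε e),
      fun S => projClass ((limitPoint a b k hm hd).2 S)
        (twistedForms S (slopeDiff k m d S ε) (slopeCoord k (u ε) ε)))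
  have hY0 : Y 0 = limitPoint a b k hm hd := by
    refine Prod.ext (funext fun e => ?_) (funext fun S => ?_)
    · simp only [Y, hu0]
      exact projClass_of_ne _ _
    · simp only [Y, hu0]
      exact projClass_of_ne _ _
  have hYc : ContinuousAt Y 0 := by
    refine ContinuousAt.prodMk (continuousAt_pi.2 fun e => ?_) (continuousAt_pi.2 fun S => ?_)
    · refine ContinuousAt.comp (f := fun ε => slopeCoord k (u ε) ε e)
        (continuousAt_projClass _ ?_) (hr e).continuousAt
      rw [hu0]
      exact slopeCoord_ne_zero k hm 0 e
    · refine ContinuousAt.comp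
        (f := fun ε => twistedForms S (slopeDiff k m d S ε) (slopeCoord k (u ε) ε))
        (continuousAt_projClass _ ?_) (continuous_twistedForms S (hδ S) hr).continuousAt
      rw [hu0]
      exact twistedForms_slopeDiff_ne_zero k hm hd S
  have hlim : Tendsto Y (𝓝[≠] 0) (𝓝 (limitPoint a b k hm hd)) := by
    rw [← hY0]
    exact hYc.tendsto.mono_left nhdsWithin_le_nhds
  refine mem_closure_of_tendsto hlim ?_
  have hev1 : ∀ᶠ ε in 𝓝[≠] (0 : ℂ), ∀ q, u ε q ≠ 0 := by
    refine eventually_all.2 fun q => (Tendsto.eventually_ne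
      (((continuous_pi_iff.1 huc) q).tendsto 0) ?_).filter_mono nhdsWithin_le_nhds
    rw [hu0]
    exact hm q
  have hev2 : ∀ᶠ ε in 𝓝[≠] (0 : ℂ), ∀ e : Pairs n a b,
      slopeCoord k (u ε) ε e 0 ≠ slopeCoord k (u ε) ε e 1 := by
    refine eventually_all.2 fun e => ?_
    by_cases h : k e.1.1 = k e.1.2 ∧ m e.1.1 = m e.1.2
    · filter_upwards [self_mem_nhdsWithin] with ε hε
      have hde : d e.1.2 ≠ d e.1.1 := hd.ne e.2.1.ne'
      simpa [slopeCoord, u, h.1, h.2] using ⟨hde, hε⟩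
    · have h1 : Continuous fun ε => slopeCoord k (u ε) ε e 0 - slopeCoord k (u ε) ε e 1 :=
        ((continuous_pi_iff.1 (hr e)) 0).sub ((continuous_pi_iff.1 (hr e)) 1)
      have h2 : slopeCoord k (u 0) 0 e 0 - slopeCoord k (u 0) 0 e 1 ≠ 0 := by
        rw [hu0, sub_ne_zero]
        exact fun h' => h ((slopeCoord_zero_eq_iff k hm e).1 h')
      exact ((h1.continuousAt.eventually_ne h2).filter_mono nhdsWithin_le_nhds).mono
        fun ε h => sub_ne_zero.1 h
  filter_upwards [hev1, hev2, self_mem_nhdsWithin] with ε h1 h2 hε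
  have hcoord : IsHomogeneousCoord (slopeCoord k (u ε) ε) (Y ε).1 := fun e =>
    ⟨slopeCoord_ne_zero k h1 ε e, projClass_of_ne _ _⟩
  refine ⟨subset_closure (mem_chartSolutions_main hab k hε h1 h2 hcoord), _, hcoord, fun S => ?_⟩
  obtain ⟨p, hp, q, hq, hpq⟩ := S.exists_ne
  obtain ⟨e, he1, he2, -⟩ := S.exists_pair (P := fun p q => p ≠ q) ⟨p, hp, q, hq, hpq, hpq⟩
    fun _ _ => Ne.symm
  have hne : centerForms S (slopeCoord k (u ε) ε) ≠ 0 := by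
    rw [centerForms_eq_twistedForms]
    exact twistedForms_ne_zero (slopeCoord_ne_zero k h1 ε) he1 he2 (sub_ne_zero.2 (h2 e))
  refine ⟨hne, ?_⟩
  by_cases hS : IsCoincident k m S
  · -- The forms are divisible by `ε`.
    have heq : centerForms S (slopeCoord k (u ε) ε) =
        ε • twistedForms S (slopeDiff k m d S ε) (slopeCoord k (u ε) ε) := by
      rw [← twistedForms_smul, centerForms_eq_twistedForms]
      funext i
      simp only [twistedForms]
      split_ifs with hi
      · obtain ⟨hk, hm'⟩ := hS _ hi.1 _ hi.2
        congr 1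
        simp only [slopeDiff, if_pos hS]
        simp [slopeCoord, u, hk, hm']
        ring
      · rfl
    have hne' : twistedForms S (slopeDiff k m d S ε) (slopeCoord k (u ε) ε) ≠ 0 := by
      rw [heq] at hne
      exact (smul_ne_zero_iff.1 hne).2
    refine (projClass_of_ne _ hne').trans ?_
    rw [Projectivization.mk_eq_mk_iff']
    exact ⟨ε⁻¹, by rw [heq, inv_smul_smul₀ hε]⟩
  · have heq : twistedForms S (slopeDiff k m d S ε) (slopeCoord k (u ε) ε) =
        centerForms S (slopeCoord k (u ε) ε) := by
      rw [centerForms_eq_twistedForms]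
      congr 1
      funext e
      simp only [slopeDiff, if_neg hS, u]
    simp only [Y, heq]
    exact projClass_of_ne _ hne

/-! ### Chart coordinates -/

theorem mem_planeOf_iff {z w : Fin n → ℂ} {hza : z a = 1} {hzb : z b = 0} {hwa : w a = 0}
    {hwb : w b = 1} {x : Fin n → ℂ} :
    x ∈ (planeOf hza hzb hwa hwb).1 ↔ ∃ s t : ℂ, s • z + t • w = x := by
  have hr : Set.range ![z, w] = {z, w} := by
    ext y; simp [eq_comm, or_comm]
  change x ∈ Submodule.span ℂ (Set.range ![z, w]) ↔ _
  rw [hr, Submodule.mem_span_pair]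

theorem exists_isChartCoord {L : Grassmannian n} (h : PluckerNeZero L a b) :
    ∃ z w, IsChartCoord a b L z w := by
  obtain ⟨u, hu, v, hv, h⟩ := h
  set D := u a * v b - u b * v a with hD
  refine ⟨D⁻¹ • (v b • u - u b • v), D⁻¹ • (u a • v - v a • u),
    L.1.smul_mem _ (L.1.sub_mem (L.1.smul_mem _ hu) (L.1.smul_mem _ hv)),
    L.1.smul_mem _ (L.1.sub_mem (L.1.smul_mem _ hv) (L.1.smul_mem _ hu)), ?_, ?_, ?_, ?_⟩ <;>
  simp only [Pi.smul_apply, Pi.sub_apply, smul_eq_mul]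
  · rw [inv_mul_eq_one₀ h, hD]; ring
  · ring
  · ring
  · rw [inv_mul_eq_one₀ h, hD]; ring

namespace IsChartCoord

variable {L : Grassmannian n} {z w : Fin n → ℂ}

theorem eq_planeOf (h : IsChartCoord a b L z w) :
    L = planeOf h.2.2.1 h.2.2.2.1 h.2.2.2.2.1 h.2.2.2.2.2 := by
  refine Subtype.ext (Submodule.eq_of_le_of_finrank_eq ?_ ?_).symm
  · intro x hx
    obtain ⟨s, t, rfl⟩ := mem_planeOf_iff.1 hx
    exact L.1.add_mem (L.1.smul_mem _ h.1) (L.1.smul_mem _ h.2.1)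
  · rw [L.2]
    exact (planeOf h.2.2.1 h.2.2.2.1 h.2.2.2.2.1 h.2.2.2.2.2).2

/-- A vector of `L` is determined by its coordinates `a` and `b`. -/
theorem eq_of_mem (h : IsChartCoord a b L z w) {x : Fin n → ℂ} (hx : x ∈ L.1) :
    x = x a • z + x b • w := by
  rw [h.eq_planeOf] at hx
  obtain ⟨s, t, rfl⟩ := mem_planeOf_iff.1 hx
  obtain ⟨-, -, h1, h2, h3, h4⟩ := h
  simp [h1, h2, h3, h4]

theorem unique (h : IsChartCoord a b L z w) {z' w' : Fin n → ℂ}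
    (h' : IsChartCoord a b L z' w') : z' = z ∧ w' = w := by
  have h1 := h.eq_of_mem h'.1
  have h2 := h.eq_of_mem h'.2.1
  obtain ⟨-, -, h3, h4, h5, h6⟩ := h'
  rw [h3, h4, one_smul, zero_smul, add_zero] at h1
  rw [h5, h6, one_smul, zero_smul, zero_add] at h2
  exact ⟨h1, h2⟩

theorem pluckerNeZero_iff (h : IsChartCoord a b L z w) (i j : Fin n) :
    PluckerNeZero L i j ↔ z i * w j - w i * z j ≠ 0 := by
  have := pluckerNeZero_planeOf_iff h.2.2.1 h.2.2.2.1 h.2.2.2.2.1 h.2.2.2.2.2 i j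
  rwa [← h.eq_planeOf] at this

theorem pluckerNeZero_left_iff (h : IsChartCoord a b L z w) (j : Fin n) :
    PluckerNeZero L a j ↔ w j ≠ 0 := by
  rw [h.pluckerNeZero_iff, h.2.2.1, h.2.2.2.2.1]; simp

theorem pluckerNeZero_right_iff (h : IsChartCoord a b L z w) (i : Fin n) :
    PluckerNeZero L i b ↔ z i ≠ 0 := by
  rw [h.pluckerNeZero_iff, h.2.2.2.1, h.2.2.2.2.2]; simp

end IsChartCoord

theorem diagEquiv_mem_smul {L : Grassmannian n} {x : Fin n → ℂ} (t : Fin n → ℂˣ) (hx : x ∈ L.1) :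
    diagEquiv t x ∈ (t • L).1 :=
  Submodule.mem_map_of_mem hx

theorem IsChartCoord.smul {L : Grassmannian n} {z w : Fin n → ℂ} (h : IsChartCoord a b L z w)
    (t : Fin n → ℂˣ) :
    IsChartCoord a b (t • L) ((t a : ℂ)⁻¹ • diagEquiv t z) ((t b : ℂ)⁻¹ • diagEquiv t w) := by
  obtain ⟨h1, h2, h3, h4, h5, h6⟩ := h
  refine ⟨Submodule.smul_mem _ _ (diagEquiv_mem_smul t h1),
    Submodule.smul_mem _ _ (diagEquiv_mem_smul t h2), ?_, ?_, ?_, ?_⟩ <;>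
  simp [h3, h4, h5, h6]

theorem PluckerNeZero.smul {L : Grassmannian n} {i j : Fin n} (h : PluckerNeZero L i j)
    (t : Fin n → ℂˣ) : PluckerNeZero (t • L) i j := by
  obtain ⟨u, hu, v, hv, h⟩ := h
  refine ⟨_, diagEquiv_mem_smul t hu, _, diagEquiv_mem_smul t hv, ?_⟩
  simp only [diagEquiv_apply]
  have h1 : (t i : ℂ) * (t j : ℂ) * (u i * v j - u j * v i) ≠ 0 :=
    mul_ne_zero (mul_ne_zero (t i).ne_zero (t j).ne_zero) h
  intro h2
  apply h1
  linear_combination h2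

theorem pluckerNeZero_smul_iff {L : Grassmannian n} {i j : Fin n} (t : Fin n → ℂˣ) :
    PluckerNeZero (t • L) i j ↔ PluckerNeZero L i j :=
  ⟨fun h => by simpa using h.smul t⁻¹, fun h => h.smul t⟩

theorem PluckerNeZero.symm {L : Grassmannian n} {i j : Fin n} (h : PluckerNeZero L i j) :
    PluckerNeZero L j i := by
  obtain ⟨u, hu, v, hv, h⟩ := h
  exact ⟨v, hv, u, hu, by convert h using 1; ring⟩

theorem not_pluckerNeZero_self (L : Grassmannian n) (i : Fin n) : ¬PluckerNeZero L i i := by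
  rintro ⟨u, -, v, -, h⟩
  exact h (sub_self _)

section Stratum

variable {σ : Set (Fin n × Fin n)} {L L' : Grassmannian n}

theorem pluckerNeZero_iff_of_mem_stratum (hL : L ∈ stratum σ) (hL' : L' ∈ stratum σ)
    (i j : Fin n) : PluckerNeZero L i j ↔ PluckerNeZero L' i j := by
  have key : ∀ i j : Fin n, i < j → (PluckerNeZero L i j ↔ PluckerNeZero L' i j) := by
    intro i j hij
    have h := Set.ext_iff.1 ((show _ = σ from hL).trans (show _ = σ from hL').symm) (i, j)
    simpa [hij] using h
  rcases lt_trichotomy i j with h | rfl | h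
  · exact key i j h
  · simp [not_pluckerNeZero_self]
  · exact ⟨fun h' => ((key j i h).1 h'.symm).symm, fun h' => ((key j i h).2 h'.symm).symm⟩

theorem mem_stratum_of_pluckerNeZero_iff (hL : L ∈ stratum σ)
    (h : ∀ i j, PluckerNeZero L' i j ↔ PluckerNeZero L i j) : L' ∈ stratum σ := by
  have hL' : {e : Fin n × Fin n | e.1 < e.2 ∧ PluckerNeZero L e.1 e.2} = σ := hL
  change {e : Fin n × Fin n | e.1 < e.2 ∧ PluckerNeZero L' e.1 e.2} = σ
  rw [← hL']
  ext e
  simp [h]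

theorem pluckerNeZero_of_mem_index (hL : L ∈ stratum σ) (hab : (a, b) ∈ σ) :
    a < b ∧ PluckerNeZero L a b := by
  have hL' : {e : Fin n × Fin n | e.1 < e.2 ∧ PluckerNeZero L e.1 e.2} = σ := hL
  rw [← hL'] at hab
  exact hab

end Stratum

/-! ### Continuity of the chart coordinates -/

open Classical in
/-- The chart coordinates `(z, w)` of a plane in the chart `M_{ab}`, and `(0, 0)` outside of the
chart. -/
def chartCoord (a b : Fin n) (L : Grassmannian n) : (Fin n → ℂ) × (Fin n → ℂ) :=
  if h : PluckerNeZero L a b then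
    ((exists_isChartCoord h).choose, (exists_isChartCoord h).choose_spec.choose)
  else 0

theorem isChartCoord_chartCoord {L : Grassmannian n} (h : PluckerNeZero L a b) :
    IsChartCoord a b L (chartCoord a b L).1 (chartCoord a b L).2 := by
  rw [chartCoord, dif_pos h]
  exact (exists_isChartCoord h).choose_spec.choose_spec

theorem IsChartCoord.chartCoord_eq {L : Grassmannian n} {z w : Fin n → ℂ}
    (h : IsChartCoord a b L z w) : chartCoord a b L = (z, w) := by
  have hP : PluckerNeZero L a b := ⟨z, h.1, w, h.2.1, by
    obtain ⟨-, -, h1, h2, h3, h4⟩ := h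
    simp [h1, h2, h3, h4]⟩
  obtain ⟨h1, h2⟩ := h.unique (isChartCoord_chartCoord hP)
  exact Prod.ext h1 h2

theorem isQuotientMap_plane (n : ℕ) : IsQuotientMap (Frame.plane (n := n)) := by
  refine (isQuotientMap_iff _).2 ⟨⟨rfl⟩, fun L => ?_⟩
  let B := Module.finBasisOfFinrankEq ℂ L.1 L.2
  refine ⟨⟨fun i => (B i : Fin n → ℂ), ?_⟩, Subtype.ext ?_⟩
  · exact B.linearIndependent.map' L.1.subtype (Submodule.ker_subtype _)
  · change Submodule.span ℂ (Set.range fun i => ((B i : L.1) : Fin n → ℂ)) = L.1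
    rw [show (Set.range fun i => ((B i : L.1) : Fin n → ℂ)) = L.1.subtype '' Set.range B by
      rw [← Set.range_comp]; rfl, Submodule.span_image, B.span_eq, Submodule.map_top,
      Submodule.range_subtype]

theorem continuous_frame_minor (a b : Fin n) :
    Continuous fun v : Frame n => v.1 0 a * v.1 1 b - v.1 1 a * v.1 0 b := by
  have h : ∀ i j, Continuous fun v : Frame n => v.1 i j := fun i j =>
    (continuous_apply j).comp ((continuous_apply i).comp continuous_subtype_val)
  exact ((h 0 a).mul (h 1 b)).sub ((h 1 a).mul (h 0 b))

theorem isOpen_setOf_pluckerNeZero (a b : Fin n) :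
    IsOpen {L : Grassmannian n | PluckerNeZero L a b} := by
  rw [← (isQuotientMap_plane n).isOpen_preimage]
  have : Frame.plane ⁻¹' {L : Grassmannian n | PluckerNeZero L a b} =
      {v : Frame n | v.1 0 a * v.1 1 b - v.1 1 a * v.1 0 b ≠ 0} := by
    ext v
    exact pluckerNeZero_plane_iff v a b
  rw [this]
  exact isOpen_ne.preimage (continuous_frame_minor a b)

theorem continuousOn_chartCoord (a b : Fin n) :
    ContinuousOn (chartCoord a b) {L : Grassmannian n | PluckerNeZero L a b} := by
  rw [(isQuotientMap_plane n).continuousOn_isOpen_iff (isOpen_setOf_pluckerNeZero a b)]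
  let D : Frame n → ℂ := fun v => v.1 0 a * v.1 1 b - v.1 1 a * v.1 0 b
  have hD : ContinuousOn (fun v => (D v)⁻¹)
      (Frame.plane ⁻¹' {L : Grassmannian n | PluckerNeZero L a b}) := by
    refine ContinuousOn.inv₀ (continuous_frame_minor a b).continuousOn fun v hv => ?_
    exact (pluckerNeZero_plane_iff v a b).1 hv
  refine ContinuousOn.congr (f := fun v : Frame n =>
    ((D v)⁻¹ • (v.1 1 b • v.1 0 - v.1 0 b • v.1 1),
      (D v)⁻¹ • (v.1 0 a • v.1 1 - v.1 1 a • v.1 0))) ?_ fun v hv => ?_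
  · have h : ∀ i, Continuous fun v : Frame n => v.1 i := fun i =>
      (continuous_apply i).comp continuous_subtype_val
    have h' : ∀ i j, Continuous fun v : Frame n => v.1 i j := fun i j =>
      (continuous_apply j).comp (h i)
    exact (hD.smul (((h' 1 b).smul (h 0)).sub ((h' 0 b).smul (h 1))).continuousOn).prodMk
      (hD.smul (((h' 0 a).smul (h 1)).sub ((h' 1 a).smul (h 0))).continuousOn)
  · have hv' : D v ≠ 0 := (pluckerNeZero_plane_iff v a b).1 hv
    have h0 : v.1 0 ∈ v.plane.1 := Submodule.subset_span ⟨0, rfl⟩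
    have h1 : v.1 1 ∈ v.plane.1 := Submodule.subset_span ⟨1, rfl⟩
    refine IsChartCoord.chartCoord_eq ⟨Submodule.smul_mem _ _ (Submodule.sub_mem _
      (Submodule.smul_mem _ _ h0) (Submodule.smul_mem _ _ h1)), Submodule.smul_mem _ _
      (Submodule.sub_mem _ (Submodule.smul_mem _ _ h1) (Submodule.smul_mem _ _ h0)), ?_, ?_, ?_, ?_⟩ <;>
    simp only [Pi.smul_apply, Pi.sub_apply, smul_eq_mul]
    · rw [inv_mul_eq_one₀ hv']; simp only [D]; ring
    · ring
    · ring
    · rw [inv_mul_eq_one₀ hv']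

/-! ### Orbits of the algebraic torus -/

/-- Two planes whose chart coordinates have the same zeros, and whose slopes `w_q / z_q` differ by a
constant factor, lie in the same orbit of the algebraic torus. -/
theorem exists_smul_eq_of_slopes {L L' : Grassmannian n} {z w z' w' : Fin n → ℂ}
    (h : IsChartCoord a b L z w) (h' : IsChartCoord a b L' z' w')
    (hz : ∀ q, z q = 0 ↔ z' q = 0) (hw : ∀ q, w q = 0 ↔ w' q = 0) {c : ℂ} (hc : c ≠ 0)
    (hcq : ∀ q, z q ≠ 0 → w q ≠ 0 → z q * w' q = c * w q * z' q) :
    ∃ t : Fin n → ℂˣ, t • L' = L := by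
  have key : ∀ q, ∃ t : ℂˣ, t * z' q = z q ∧ t * w' q = c * w q := by
    intro q
    by_cases hzq : z q = 0
    · have hzq' := (hz q).1 hzq
      by_cases hwq : w q = 0
      · exact ⟨1, by simp [hzq, hzq', hwq, (hw q).1 hwq]⟩
      · have hwq' : w' q ≠ 0 := fun h => hwq ((hw q).2 h)
        refine ⟨Units.mk0 (c * w q / w' q) (by positivity), ?_, ?_⟩
        · simp [hzq, hzq']
        · simp [hwq']
    · have hzq' : z' q ≠ 0 := fun h => hzq ((hz q).2 h)
      refine ⟨Units.mk0 (z q / z' q) (by positivity), by simp [hzq'], ?_⟩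
      rw [Units.val_mk0]
      by_cases hwq : w q = 0
      · simp [hwq, (hw q).1 hwq]
      · rw [div_mul_eq_mul_div, hcq q hzq hwq, mul_div_cancel_right₀ _ hzq']
  choose t ht1 ht2 using key
  refine ⟨t, ?_⟩
  have e1 : diagEquiv t z' = z := funext ht1
  have e2 : c⁻¹ • diagEquiv t w' = w := funext fun q => by
    simp [ht2, hc]
  have hcoord : IsChartCoord a b (t • L') z w := by
    refine ⟨?_, ?_, h.2.2⟩
    · rw [← e1]; exact diagEquiv_mem_smul t h'.1
    · rw [← e2]; exact Submodule.smul_mem _ _ (diagEquiv_mem_smul t h'.2.1)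
  rw [hcoord.eq_planeOf, ← h.eq_planeOf]

/-! ### Critical points -/

theorem circle_smul_eq (t : Fin n → Circle) (L : Grassmannian n) :
    t • L = (fun i => Circle.toUnits (t i)) • L := rfl

theorem diagonalCircle_le_stabilizer (L : Grassmannian n) :
    diagonalCircle n ≤ MulAction.stabilizer (Fin n → Circle) L := by
  rintro _ ⟨c, rfl⟩
  rw [MulAction.mem_stabilizer_iff, circle_smul_eq]
  refine Subtype.ext (Submodule.eq_of_le_of_finrank_eq ?_ ?_)
  · rintro _ ⟨x, hx, rfl⟩
    exact L.1.smul_mem (c : ℂ) hx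
  · rw [L.2]
    exact Subtype.property (_ : Grassmannian n)

/-- The plane of a critical point has a vanishing column, or only two directions among its columns:
an element of the stabilizer acts on `L` by a linear map with the columns as eigenvectors. -/
theorem exists_eq_zero_or_forall_mul_eq_zero {L : Grassmannian n} {z w : Fin n → ℂ}
    (h : IsChartCoord a b L z w)
    (hL : MulAction.stabilizer (Fin n → Circle) L ≠ diagonalCircle n) :
    (∃ p, z p = 0 ∧ w p = 0) ∨ ∀ p, z p = 0 ∨ w p = 0 := by
  by_contra hcon
  push Not at hcon
  obtain ⟨hloop, p, hzp, hwp⟩ := hcon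
  refine hL (le_antisymm (fun t ht => ?_) (diagonalCircle_le_stabilizer L))
  rw [MulAction.mem_stabilizer_iff, circle_smul_eq] at ht
  have hcoord := h.smul fun i => Circle.toUnits (t i)
  rw [ht] at hcoord
  obtain ⟨h1, h2⟩ := h.unique hcoord
  have hz : ∀ q, z q ≠ 0 → t q = t a := by
    intro q hq
    have h3 := congrFun h1 q
    simp only [Pi.smul_apply, diagEquiv_apply, smul_eq_mul, ← mul_assoc] at h3
    have h4 := mul_right_cancel₀ hq (h3.trans (one_mul _).symm)
    rw [inv_mul_eq_one₀ (Units.ne_zero _)] at h4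
    exact (Circle.ext h4).symm
  have hw : ∀ q, w q ≠ 0 → t q = t b := by
    intro q hq
    have h3 := congrFun h2 q
    simp only [Pi.smul_apply, diagEquiv_apply, smul_eq_mul, ← mul_assoc] at h3
    have h4 := mul_right_cancel₀ hq (h3.trans (one_mul _).symm)
    rw [inv_mul_eq_one₀ (Units.ne_zero _)] at h4
    exact (Circle.ext h4).symm
  have hab : t b = t a := (hw p hwp).symm.trans (hz p hzp)
  refine ⟨t a, funext fun q => ?_⟩
  change t a = t q
  by_cases hq : z q = 0
  · exact ((hw q (hloop q hq)).trans hab).symm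
  · exact (hz q hq).symm

variable {σ : Set (Fin n × Fin n)}

/-! ### Points of the virtual space of parameters -/

/-- If the slopes `w_q / z_q` are `m q` where they are finite and nonzero (with exponent
`k q = 1`), and zero or infinite where the exponent `k q` is `2` or `0`, then the limit point solves
the equations of the plane. Columns `z_q = w_q = 0` may have any exponent and any slope. -/
theorem limitPoint_mem_virtualSpace (hab : a ≠ b) {L : Grassmannian n} (hL : L ∈ stratum σ)
    {z w : Fin n → ℂ} (h : IsChartCoord a b L z w) {k : Fin n → ℕ} {m d : Fin n → ℂ}
    (hm : ∀ q, m q ≠ 0) (hd : Function.Injective d)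
    (h1 : ∀ q, q ≠ a → q ≠ b → z q ≠ 0 → w q ≠ 0 → k q = 1 ∧ w q = m q * z q)
    (h2 : ∀ q, q ≠ a → q ≠ b → z q ≠ 0 → w q = 0 → k q = 2)
    (h3 : ∀ q, q ≠ a → q ≠ b → z q = 0 → w q ≠ 0 → k q = 0) :
    limitPoint a b k hm hd ∈ virtualSpace σ a b := by
  refine ⟨limitPoint_mem_universalSpace hab k hm hd, L, hL, z, w, h, slopeCoord k m 0,
    fun e => ⟨slopeCoord_ne_zero k hm 0 e, rfl⟩, ?_⟩
  rintro ⟨⟨p, q⟩, hpq, hpa, hpb, hqa, hqb⟩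
  change 0 ^ (k p - k q) * m p * (z p * w q) = 0 ^ (k q - k p) * m q * (z q * w p)
  simp only at hpa hpb hqa hqb
  by_cases hzp : z p = 0 <;> by_cases hwp : w p = 0 <;> by_cases hzq : z q = 0 <;>
    by_cases hwq : w q = 0
  all_goals try (simp [*]; done)
  rw [(h1 p hpa hpb hzp hwp).1, (h1 q hqa hqb hzq hwq).1, (h1 p hpa hpb hzp hwp).2,
    (h1 q hqa hqb hzq hwq).2]
  ring

/-- The numbers `0, 1, …, n - 1` serve as pairwise different first-order corrections of the slopes. -/
theorem injective_natCast_fin (n : ℕ) : Function.Injective fun q : Fin n => ((q : ℕ) : ℂ) :=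
  fun _ _ h => Fin.ext (Nat.cast_injective h)

/-! ### Planes with two directions of columns -/

theorem coord_eq_zero_iff {L L' : Grassmannian n} (hL : L ∈ stratum σ) (hL' : L' ∈ stratum σ)
    {z w z' w' : Fin n → ℂ} (h : IsChartCoord a b L z w) (h' : IsChartCoord a b L' z' w')
    (q : Fin n) : (z q = 0 ↔ z' q = 0) ∧ (w q = 0 ↔ w' q = 0) := by
  rw [← not_iff_not, ← not_iff_not (a := w q = 0), ← Ne, ← Ne, ← Ne, ← Ne,
    ← h.pluckerNeZero_right_iff, ← h'.pluckerNeZero_right_iff, ← h.pluckerNeZero_left_iff,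
    ← h'.pluckerNeZero_left_iff]
  exact ⟨pluckerNeZero_iff_of_mem_stratum hL hL' _ _, pluckerNeZero_iff_of_mem_stratum hL hL' _ _⟩

/-- Without generic columns there are no slopes to compare, so the torus acts transitively on the
stratum. -/
theorem subsingleton_parameterSpace (hab : (a, b) ∈ σ) {L : Grassmannian n} (hL : L ∈ stratum σ)
    {z w : Fin n → ℂ} (h : IsChartCoord a b L z w) (hzw : ∀ p, z p = 0 ∨ w p = 0) :
    Subsingleton (ParameterSpace σ) := by
  refine ⟨fun x y => ?_⟩
  induction x using Quotient.inductionOn with | _ L₁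
  induction y using Quotient.inductionOn with | _ L₂
  have h₁ := isChartCoord_chartCoord (pluckerNeZero_of_mem_index L₁.2 hab).2
  have h₂ := isChartCoord_chartCoord (pluckerNeZero_of_mem_index L₂.2 hab).2
  obtain ⟨t, ht⟩ := exists_smul_eq_of_slopes h₁ h₂
    (fun q => (coord_eq_zero_iff L₁.2 L₂.2 h₁ h₂ q).1)
    (fun q => (coord_eq_zero_iff L₁.2 L₂.2 h₁ h₂ q).2) one_ne_zero fun q hz hw => by
      rcases hzw q with h0 | h0
      · exact absurd ((coord_eq_zero_iff hL L₁.2 h h₁ q).1.1 h0) hz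
      · exact absurd ((coord_eq_zero_iff hL L₁.2 h h₁ q).2.1 h0) hw
  exact Quotient.sound ⟨t, ht⟩

/-- Among three columns outside of the chart two are on the same side, and their ratio is not
determined by the equations of the plane. -/
theorem nontrivial_virtualSpace (hn : 5 ≤ n) (hab : a ≠ b) {L : Grassmannian n}
    (hL : L ∈ stratum σ) {z w : Fin n → ℂ} (h : IsChartCoord a b L z w)
    (hzw : ∀ p, z p = 0 ∨ w p = 0) : Nontrivial (virtualSpace σ a b) := by
  classical
  let k : Fin n → ℕ := fun q => if z q = 0 then 0 else 2
  obtain ⟨p, hp, q, hq, hpq, hk⟩ := Finset.exists_ne_map_eq_of_card_lt_of_maps_to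
    (s := Finset.univ \ {a, b}) (t := ({0, 2} : Finset ℕ)) (f := k) (by
      have h1 := Finset.le_card_sdiff {a, b} (Finset.univ : Finset (Fin n))
      have h2 := Finset.card_le_two (a := a) (b := b)
      rw [Finset.card_univ, Fintype.card_fin] at h1
      have h3 : ({0, 2} : Finset ℕ).card = 2 := rfl
      omega) (fun x _ => by
      simp only [k]
      split_ifs <;> simp)
  simp only [Finset.mem_sdiff, Finset.mem_univ, Finset.mem_insert, Finset.mem_singleton, true_and,
    not_or] at hp hq
  have hmem : ∀ (m : Fin n → ℂ) (hm : ∀ q, m q ≠ 0),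
      limitPoint a b k hm (injective_natCast_fin n) ∈ virtualSpace σ a b := by
    intro m hm
    refine limitPoint_mem_virtualSpace hab hL h hm _ (fun q _ _ hz hw => ?_)
      (fun q _ _ hz _ => if_neg hz) (fun q _ _ hz _ => if_pos hz)
    exact ((hzw q).elim hz hw).elim
  have hm₁ : ∀ q : Fin n, (1 : Fin n → ℂ) q ≠ 0 := fun q => one_ne_zero
  have hm₂ : ∀ q : Fin n, (fun q => if q = p then 2 else 1 : Fin n → ℂ) q ≠ 0 := fun q => by
    dsimp only
    split_ifs <;> norm_num
  refine ⟨⟨_, hmem _ hm₁⟩, ⟨_, hmem _ hm₂⟩, fun heq => ?_⟩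
  have := eq_of_limitPoint_eq hm₁ hm₂ (injective_natCast_fin n) (congrArg Subtype.val heq)
    hpq hp.1 hp.2 hq.1 hq.2 hk
  simp [hpq.symm] at this

/-! ### Planes with a vanishing column -/

/-- The columns of `L` which are not proportional to the columns `a` or `b`, and not zero. -/
def genericColumns (a b : Fin n) (L : Grassmannian n) : Set (Fin n) :=
  {q | PluckerNeZero L a q ∧ PluckerNeZero L q b}

theorem IsChartCoord.mem_genericColumns_iff {L : Grassmannian n} {z w : Fin n → ℂ}
    (h : IsChartCoord a b L z w) {q : Fin n} :
    q ∈ genericColumns a b L ↔ z q ≠ 0 ∧ w q ≠ 0 := by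
  rw [← h.pluckerNeZero_left_iff, ← h.pluckerNeZero_right_iff, and_comm]
  rfl

/-- The affine space which contains the slopes of all planes in the stratum of `L`, normalized to be
`1` at the column `p`, with the constant function `1` as origin. The slopes of proportional columns
are equal. -/
def slopeSpace (a b : Fin n) (L : Grassmannian n) (p : Fin n) : Submodule ℝ (Fin n → ℂ) where
  carrier := {μ | μ p = 0 ∧ (∀ q ∉ genericColumns a b L, μ q = 0) ∧
    ∀ q ∈ genericColumns a b L, ∀ r ∈ genericColumns a b L, ¬PluckerNeZero L q r → μ q = μ r}
  add_mem' := by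
    rintro μ ν ⟨h1, h2, h3⟩ ⟨h4, h5, h6⟩
    refine ⟨by simp [h1, h4], fun q hq => by simp [h2 q hq, h5 q hq], fun q hq r hr hqr => ?_⟩
    simp [h3 q hq r hr hqr, h6 q hq r hr hqr]
  zero_mem' := by simp
  smul_mem' := by
    rintro c μ ⟨h1, h2, h3⟩
    refine ⟨by simp [h1], fun q hq => by simp [h2 q hq], fun q hq r hr hqr => ?_⟩
    simp [h3 q hq r hr hqr]

open Classical in
/-- The slopes `w_q / z_q` in the columns `q ∈ Q`, normalized at the column `p`, minus one. -/
def normalizedSlopes (a b : Fin n) (Q : Set (Fin n)) (p : Fin n) (L : Grassmannian n) :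
    Fin n → ℂ := fun q =>
  if q ∈ Q then ((chartCoord a b L).2 q * (chartCoord a b L).1 p) /
    ((chartCoord a b L).1 q * (chartCoord a b L).2 p) - 1 else 0

theorem chartCoord_ne_zero {L L' : Grassmannian n} (hab : (a, b) ∈ σ) (hL : L ∈ stratum σ)
    (hL' : L' ∈ stratum σ) {q : Fin n} (hq : q ∈ genericColumns a b L) :
    (chartCoord a b L').1 q ≠ 0 ∧ (chartCoord a b L').2 q ≠ 0 := by
  rw [← (isChartCoord_chartCoord
    (pluckerNeZero_of_mem_index hL' hab).2).mem_genericColumns_iff]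
  exact ⟨(pluckerNeZero_iff_of_mem_stratum hL hL' _ _).1 hq.1,
    (pluckerNeZero_iff_of_mem_stratum hL hL' _ _).1 hq.2⟩

theorem normalizedSlopes_eq_iff {L L' : Grassmannian n} (hab : (a, b) ∈ σ) (hL : L ∈ stratum σ)
    (hL' : L' ∈ stratum σ) {p q r : Fin n} (hp : p ∈ genericColumns a b L)
    (hq : q ∈ genericColumns a b L) (hr : r ∈ genericColumns a b L) :
    normalizedSlopes a b (genericColumns a b L) p L' q =
      normalizedSlopes a b (genericColumns a b L) p L' r ↔ ¬PluckerNeZero L q r := by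
  rw [pluckerNeZero_iff_of_mem_stratum hL hL',
    (isChartCoord_chartCoord (pluckerNeZero_of_mem_index hL' hab).2).pluckerNeZero_iff, not_not]
  obtain ⟨h1, h2⟩ := chartCoord_ne_zero hab hL hL' hp
  obtain ⟨h3, h4⟩ := chartCoord_ne_zero hab hL hL' hq
  obtain ⟨h5, h6⟩ := chartCoord_ne_zero hab hL hL' hr
  simp only [normalizedSlopes, if_pos hq, if_pos hr, sub_left_inj]
  rw [div_eq_div_iff (mul_ne_zero h3 h2) (mul_ne_zero h5 h2)]
  constructor
  · intro h
    refine mul_left_cancel₀ (mul_ne_zero h1 h2) ?_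
    linear_combination -h
  · intro h
    linear_combination -(chartCoord a b L').1 p * (chartCoord a b L').2 p * h

theorem normalizedSlopes_mem_slopeSpace {L L' : Grassmannian n} (hab : (a, b) ∈ σ)
    (hL : L ∈ stratum σ) (hL' : L' ∈ stratum σ) {p : Fin n} (hp : p ∈ genericColumns a b L) :
    normalizedSlopes a b (genericColumns a b L) p L' ∈ slopeSpace a b L p := by
  refine ⟨?_, fun q hq => if_neg hq,
    fun q hq r hr hqr => (normalizedSlopes_eq_iff hab hL hL' hp hq hr).2 hqr⟩
  obtain ⟨h1, h2⟩ := chartCoord_ne_zero hab hL hL' hp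
  simp only [normalizedSlopes, if_pos hp]
  rw [mul_comm, div_self (mul_ne_zero h1 h2), sub_self]

/-- The normalized slopes embed the space of parameters. -/
theorem exists_continuous_injective_slopeSpace (hab : (a, b) ∈ σ) {L : Grassmannian n}
    (hL : L ∈ stratum σ) {p : Fin n} (hp : p ∈ genericColumns a b L) :
    ∃ φ : ParameterSpace σ → slopeSpace a b L p, Continuous φ ∧ Function.Injective φ := by
  classical
  set Q := genericColumns a b L with hQ
  have hcoord : ∀ L' : stratum σ,
      IsChartCoord a b L'.1 (chartCoord a b L'.1).1 (chartCoord a b L'.1).2 := fun L' =>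
    isChartCoord_chartCoord (pluckerNeZero_of_mem_index L'.2 hab).2
  have hQ' : ∀ (L' : stratum σ) (q : Fin n), q ∈ Q →
      (chartCoord a b L'.1).1 q ≠ 0 ∧ (chartCoord a b L'.1).2 q ≠ 0 := fun L' q hq =>
    chartCoord_ne_zero hab hL L'.2 hq
  have hmem : ∀ L' : stratum σ, normalizedSlopes a b Q p L'.1 ∈ slopeSpace a b L p := fun L' =>
    normalizedSlopes_mem_slopeSpace hab hL L'.2 hp
  have hinv : ∀ L₁ L₂ : stratum σ, stratumSetoid σ L₁ L₂ →
      normalizedSlopes a b Q p L₁.1 = normalizedSlopes a b Q p L₂.1 := by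
    rintro L₁ L₂ ⟨t, ht⟩
    have ht' : t • L₂.1 = L₁.1 := ht
    have h := ((hcoord L₂).smul t).chartCoord_eq
    rw [ht'] at h
    funext q
    simp only [normalizedSlopes, h]
    split_ifs with hq
    · obtain ⟨h1, h2⟩ := hQ' L₂ p hp
      obtain ⟨h3, h4⟩ := hQ' L₂ q hq
      simp only [Pi.smul_apply, diagEquiv_apply, smul_eq_mul]
      have := (t a).ne_zero
      have := (t b).ne_zero
      have := (t p).ne_zero
      have := (t q).ne_zero
      field_simp
    · rfl
  have hcont : Continuous fun L' : stratum σ => normalizedSlopes a b Q p L'.1 := by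
    have hc : Continuous fun L' : stratum σ => chartCoord a b L'.1 :=
      (continuousOn_chartCoord a b).comp_continuous continuous_subtype_val
        fun L' => (pluckerNeZero_of_mem_index L'.2 hab).2
    have hz : ∀ q, Continuous fun L' : stratum σ => (chartCoord a b L'.1).1 q := fun q =>
      (continuous_apply q).comp hc.fst
    have hw : ∀ q, Continuous fun L' : stratum σ => (chartCoord a b L'.1).2 q := fun q =>
      (continuous_apply q).comp hc.snd
    refine continuous_pi fun q => ?_
    simp only [normalizedSlopes]
    split_ifs with hq
    · exact (((hw q).mul (hz p)).div ((hz q).mul (hw p)) fun L' =>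
        mul_ne_zero (hQ' L' q hq).1 (hQ' L' p hp).2).sub continuous_const
    · exact continuous_const
  refine ⟨Quotient.lift (fun L' => ⟨_, hmem L'⟩) fun L₁ L₂ h => Subtype.ext (hinv L₁ L₂ h),
    (Continuous.subtype_mk hcont hmem).quotient_lift _, fun x y hxy => ?_⟩
  induction x using Quotient.inductionOn with | _ L₁
  induction y using Quotient.inductionOn with | _ L₂
  have hxy' : normalizedSlopes a b Q p L₁.1 = normalizedSlopes a b Q p L₂.1 :=
    congrArg Subtype.val hxy
  obtain ⟨h1, h2⟩ := hQ' L₁ p hp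
  obtain ⟨h1', h2'⟩ := hQ' L₂ p hp
  obtain ⟨t, ht⟩ := exists_smul_eq_of_slopes (hcoord L₁) (hcoord L₂)
    (fun q => (coord_eq_zero_iff L₁.2 L₂.2 (hcoord L₁) (hcoord L₂) q).1)
    (fun q => (coord_eq_zero_iff L₁.2 L₂.2 (hcoord L₁) (hcoord L₂) q).2)
    (c := ((chartCoord a b L₁.1).1 p * (chartCoord a b L₂.1).2 p) /
      ((chartCoord a b L₁.1).2 p * (chartCoord a b L₂.1).1 p))
    (div_ne_zero (mul_ne_zero h1 h2') (mul_ne_zero h2 h1')) fun q hz hw => by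
      have hq : q ∈ Q := by
        have h := (hcoord L₁).mem_genericColumns_iff.2 ⟨hz, hw⟩
        exact ⟨(pluckerNeZero_iff_of_mem_stratum L₁.2 hL _ _).1 h.1,
          (pluckerNeZero_iff_of_mem_stratum L₁.2 hL _ _).1 h.2⟩
      have h3 := congrFun hxy' q
      obtain ⟨h4, h5⟩ := hQ' L₂ q hq
      simp only [normalizedSlopes, if_pos hq, sub_left_inj] at h3
      rw [div_eq_div_iff (mul_ne_zero hz h2) (mul_ne_zero h4 h2')] at h3
      rw [div_mul_eq_mul_div, div_mul_eq_mul_div, eq_div_iff (mul_ne_zero h2 h1')]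
      linear_combination -h3
  exact Quotient.sound ⟨t, ht⟩

/-! ### A free parameter in the virtual space of parameters -/

/-- The pairs `(μ, s)` such that some plane in the stratum of `L` has the slopes `1 + μ q`, and such
that `s` is nonzero and different from these slopes. -/
def slopeConfigurations (a b : Fin n) (L : Grassmannian n) (p : Fin n) :
    Set (slopeSpace a b L p × ℂ) :=
  {x | (∀ q ∈ genericColumns a b L, 1 + x.1.1 q ≠ 0) ∧
    (∀ q ∈ genericColumns a b L, ∀ r ∈ genericColumns a b L,
      PluckerNeZero L q r → x.1.1 q ≠ x.1.1 r) ∧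
    x.2 ≠ 0 ∧ ∀ q ∈ genericColumns a b L, x.2 ≠ 1 + x.1.1 q}

theorem isOpen_slopeConfigurations (a b : Fin n) (L : Grassmannian n) (p : Fin n) :
    IsOpen (slopeConfigurations a b L p) := by
  have hc : ∀ q, Continuous fun x : slopeSpace a b L p × ℂ => x.1.1 q := fun q =>
    (continuous_apply q).comp (continuous_subtype_val.comp continuous_fst)
  have hne : ∀ {f g : slopeSpace a b L p × ℂ → ℂ}, Continuous f → Continuous g → ∀ x, f x ≠ g x →
      ∀ᶠ y in 𝓝 x, f y ≠ g y := fun hf hg x h => (isOpen_ne_fun hf hg).mem_nhds h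
  rw [isOpen_iff_eventually]
  rintro x ⟨h1, h2, h3, h4⟩
  refine Eventually.and ?_ (Eventually.and ?_ (Eventually.and ?_ ?_))
  · exact eventually_all.2 fun q => eventually_imp_distrib_left.2 fun hq =>
      hne (continuous_const.add (hc q)) continuous_const x (h1 q hq)
  · exact eventually_all.2 fun q => eventually_imp_distrib_left.2 fun hq =>
      eventually_all.2 fun r => eventually_imp_distrib_left.2 fun hr =>
        eventually_imp_distrib_left.2 fun hqr => hne (hc q) (hc r) x (h2 q hq r hr hqr)
  · exact hne continuous_snd continuous_const x h3
  · exact eventually_all.2 fun q => eventually_imp_distrib_left.2 fun hq =>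
      hne continuous_snd (continuous_const.add (hc q)) x (h4 q hq)

theorem slopeConfigurations_nonempty (hab : (a, b) ∈ σ) {L : Grassmannian n} (hL : L ∈ stratum σ)
    {p : Fin n} (hp : p ∈ genericColumns a b L) : (slopeConfigurations a b L p).Nonempty := by
  obtain ⟨s, hs⟩ := (Set.toFinite (insert 0 (Set.range fun q =>
    1 + normalizedSlopes a b (genericColumns a b L) p L q))).infinite_compl.nonempty
  rw [Set.mem_compl_iff, Set.mem_insert_iff, not_or] at hs
  refine ⟨(⟨_, normalizedSlopes_mem_slopeSpace hab hL hL hp⟩, s), fun q hq => ?_,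
    fun q hq r hr hqr => ?_, hs.1, fun q _ h => hs.2 ⟨q, h.symm⟩⟩
  · obtain ⟨h1, h2⟩ := chartCoord_ne_zero hab hL hL hp
    obtain ⟨h3, h4⟩ := chartCoord_ne_zero hab hL hL hq
    simp only [normalizedSlopes, if_pos hq, add_sub_cancel]
    exact div_ne_zero (mul_ne_zero h4 h1) (mul_ne_zero h3 h2)
  · exact fun h => (normalizedSlopes_eq_iff hab hL hL hp hq hr).1 h hqr

open Classical in
/-- The order of vanishing of the slope in each column for a family of planes which degenerates to
the stratum of `L`: `1` for the generic columns and for the vanishing column `p₀`, and `2` or `0` if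
the limit of the slope is to be smaller or larger. The value `3` separates the vanishing columns other
than `p₀` from all other columns. -/
def columnExponent (a b : Fin n) (L : Grassmannian n) (p₀ q : Fin n) : ℕ :=
  if q ∈ genericColumns a b L then 1 else if q = p₀ then 1
  else if PluckerNeZero L q b then 2 else if PluckerNeZero L a q then 0 else 3

open Classical in
/-- The leading coefficients of the slopes of the family of planes: `1 + μ q` for the generic columns,
`s` for the vanishing column `p₀`, and `1` for all other columns. -/
def columnSlope (a b : Fin n) (L : Grassmannian n) (p₀ : Fin n) (μ : Fin n → ℂ) (s : ℂ)
    (q : Fin n) : ℂ :=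
  if q ∈ genericColumns a b L then 1 + μ q else if q = p₀ then s else 1

section ZeroColumn

variable {L : Grassmannian n} {p p₀ : Fin n}

theorem columnSlope_ne_zero {x : slopeSpace a b L p × ℂ} (hx : x ∈ slopeConfigurations a b L p)
    (q : Fin n) : columnSlope a b L p₀ x.1.1 x.2 q ≠ 0 := by
  unfold columnSlope
  split_ifs with h
  · exact hx.1 q h
  · exact hx.2.2.1
  · exact one_ne_zero

/-- Which of the slopes of the same order agree does not depend on the configuration. -/
theorem columnSlope_eq_of_eq {x y : slopeSpace a b L p × ℂ}
    (hx : x ∈ slopeConfigurations a b L p) (q r : Fin n)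
    (hk : columnExponent a b L p₀ q = columnExponent a b L p₀ r)
    (hqr : columnSlope a b L p₀ x.1.1 x.2 q = columnSlope a b L p₀ x.1.1 x.2 r) :
    columnSlope a b L p₀ y.1.1 y.2 q = columnSlope a b L p₀ y.1.1 y.2 r := by
  by_cases hq : q ∈ genericColumns a b L <;> by_cases hr : r ∈ genericColumns a b L
  · simp only [columnSlope, if_pos hq, if_pos hr, add_right_inj] at hqr ⊢
    refine y.1.2.2.2 q hq r hr fun h => hx.2.1 q hq r hr h hqr
  · by_cases hr' : r = p₀
    · simp only [columnSlope, if_pos hq, if_neg hr, if_pos hr'] at hqr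
      exact absurd hqr.symm (hx.2.2.2 q hq)
    · simp only [columnExponent, if_pos hq, if_neg hr, if_neg hr'] at hk
      split_ifs at hk <;> omega
  · by_cases hq' : q = p₀
    · simp only [columnSlope, if_pos hr, if_neg hq, if_pos hq'] at hqr
      exact absurd hqr (hx.2.2.2 r hr)
    · simp only [columnExponent, if_pos hr, if_neg hq, if_neg hq'] at hk
      split_ifs at hk <;> omega
  · by_cases hq' : q = p₀ <;> by_cases hr' : r = p₀
    · rw [hq', hr']
    · simp only [columnExponent, if_neg hr, if_neg hq, if_pos hq', if_neg hr'] at hk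
      split_ifs at hk <;> omega
    · simp only [columnExponent, if_neg hr, if_neg hq, if_neg hq', if_pos hr'] at hk
      split_ifs at hk <;> omega
    · simp only [columnSlope, if_neg hr, if_neg hq, if_neg hq', if_neg hr']

/-- Every configuration is realized by a plane in the stratum of `L`. -/
theorem exists_plane_of_slopeConfiguration (hL : L ∈ stratum σ) {z w : Fin n → ℂ}
    (h : IsChartCoord a b L z w) {x : slopeSpace a b L p × ℂ}
    (hx : x ∈ slopeConfigurations a b L p) :
    ∃ L' ∈ stratum σ, ∃ w', IsChartCoord a b L' z w' ∧
      (∀ q ∈ genericColumns a b L, w' q = (1 + x.1.1 q) * z q) ∧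
      ∀ q ∉ genericColumns a b L, w' q = w q := by
  classical
  let w' : Fin n → ℂ := fun q => if q ∈ genericColumns a b L then (1 + x.1.1 q) * z q else w q
  have hw1 : ∀ q ∈ genericColumns a b L, w' q = (1 + x.1.1 q) * z q := fun q hq => if_pos hq
  have hw2 : ∀ q ∉ genericColumns a b L, w' q = w q := fun q hq => if_neg hq
  have ha : w' a = 0 := by
    rw [hw2 a fun h' => not_pluckerNeZero_self L a h'.1, h.2.2.2.2.1]
  have hb : w' b = 1 := by
    rw [hw2 b fun h' => not_pluckerNeZero_self L b h'.2, h.2.2.2.2.2]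
  have hc := isChartCoord_planeOf h.2.2.1 h.2.2.2.1 ha hb
  refine ⟨_, mem_stratum_of_pluckerNeZero_iff hL fun i j => ?_, w', hc, hw1, hw2⟩
  rw [hc.pluckerNeZero_iff, h.pluckerNeZero_iff]
  -- A generic column and a nongeneric one are proportional only if the latter vanishes.
  have key : ∀ i ∈ genericColumns a b L, ∀ j ∉ genericColumns a b L,
      (z i * w' j - w' i * z j ≠ 0 ↔ z i * w j - w i * z j ≠ 0) := by
    intro i hi j hj
    rw [hw1 i hi, hw2 j hj]
    have hi' := h.mem_genericColumns_iff.1 hi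
    have hj' : z j = 0 ∨ w j = 0 := by
      by_contra! h'
      exact hj (h.mem_genericColumns_iff.2 h')
    have h1 := hx.1 i hi
    rcases hj' with h0 | h0
    · simp [h0]
    · simp [h0, hi'.1, hi'.2, h1]
  by_cases hi : i ∈ genericColumns a b L <;> by_cases hj : j ∈ genericColumns a b L
  · rw [hw1 i hi, hw1 j hj, ← h.pluckerNeZero_iff]
    have hi' := (h.mem_genericColumns_iff.1 hi).1
    have hj' := (h.mem_genericColumns_iff.1 hj).1
    have : z i * ((1 + x.1.1 j) * z j) - (1 + x.1.1 i) * z i * z j =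
      z i * z j * (x.1.1 j - x.1.1 i) := by ring
    rw [this, mul_ne_zero_iff, sub_ne_zero]
    constructor
    · intro h1
      by_contra h2
      exact h1.2 (x.1.2.2.2 i hi j hj h2).symm
    · exact fun h1 => ⟨mul_ne_zero hi' hj', (hx.2.1 i hi j hj h1).symm⟩
  · exact key i hi j hj
  · have := key j hj i hi
    rw [← neg_ne_zero, ← neg_ne_zero (a := z i * w j - w i * z j)]
    convert this using 2 <;> ring
  · rw [hw2 i hi, hw2 j hj]

/-- If the column `p₀` vanishes, then its slope in the limit point is a free parameter in addition to
the slopes of the generic columns. -/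
theorem exists_continuous_injective_virtualSpace (hab : (a, b) ∈ σ) (hL : L ∈ stratum σ)
    {z w : Fin n → ℂ} (h : IsChartCoord a b L z w) (hz₀ : z p₀ = 0) (hw₀ : w p₀ = 0)
    (hp : p ∈ genericColumns a b L) :
    ∃ g : slopeConfigurations a b L p → virtualSpace σ a b,
      Continuous g ∧ Function.Injective g := by
  have hne : a ≠ b := (pluckerNeZero_of_mem_index hL hab).1.ne
  have hga : a ∉ genericColumns a b L := fun h' => not_pluckerNeZero_self L a h'.1
  have hgb : b ∉ genericColumns a b L := fun h' => not_pluckerNeZero_self L b h'.2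
  have hp₀a : p₀ ≠ a := fun h' => one_ne_zero (h.2.2.1.symm.trans (h' ▸ hz₀))
  have hp₀b : p₀ ≠ b := fun h' => one_ne_zero (h.2.2.2.2.2.symm.trans (h' ▸ hw₀))
  have hp₀ : p₀ ∉ genericColumns a b L := fun h' => (h.mem_genericColumns_iff.1 h').1 hz₀
  have hm := fun x : slopeConfigurations a b L p => columnSlope_ne_zero (p₀ := p₀) x.2
  have hd := injective_natCast_fin n
  have hmem : ∀ x : slopeConfigurations a b L p,
      limitPoint a b (columnExponent a b L p₀) (hm x) hd ∈ virtualSpace σ a b := by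
    intro x
    obtain ⟨L', hL', w', h', hw1, hw2⟩ := exists_plane_of_slopeConfiguration hL h x.2
    have hw' : ∀ q, w' q = 0 ↔ w q = 0 := fun q => (coord_eq_zero_iff hL' hL h' h q).2
    refine limitPoint_mem_virtualSpace hne hL' h' (hm x) hd (fun q _ _ hz hw => ?_)
      (fun q _ _ hz hw => ?_) (fun q _ _ hz hw => ?_)
    · have hq : q ∈ genericColumns a b L :=
        h.mem_genericColumns_iff.2 ⟨hz, fun h0 => hw ((hw' q).2 h0)⟩
      exact ⟨if_pos hq, by rw [hw1 q hq, columnSlope, if_pos hq]⟩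
    · have hq : q ∉ genericColumns a b L := fun hq =>
        (h.mem_genericColumns_iff.1 hq).2 ((hw' q).1 hw)
      have hq' : q ≠ p₀ := fun h0 => hz (h0 ▸ hz₀)
      rw [columnExponent, if_neg hq, if_neg hq', if_pos ((h.pluckerNeZero_right_iff q).2 hz)]
    · have hq : q ∉ genericColumns a b L := fun hq => (h.mem_genericColumns_iff.1 hq).1 hz
      have hwq : w q ≠ 0 := fun h0 => hw ((hw' q).2 h0)
      have hq' : q ≠ p₀ := fun h0 => hwq (h0 ▸ hw₀)
      rw [columnExponent, if_neg hq, if_neg hq',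
        if_neg fun h0 => (h.pluckerNeZero_right_iff q).1 h0 hz,
        if_pos ((h.pluckerNeZero_left_iff q).2 hwq)]
  refine ⟨fun x => ⟨_, hmem x⟩, Continuous.subtype_mk ?_ _, fun x y hxy => ?_⟩
  · refine continuous_limitPoint _ ?_ hm hd fun x y q r => columnSlope_eq_of_eq x.2 q r
    refine continuous_pi fun q => ?_
    have hx1 : Continuous fun x : slopeConfigurations a b L p => x.1.1.1 q :=
      (continuous_apply q).comp (continuous_subtype_val.comp
        (continuous_fst.comp continuous_subtype_val))
    have hx2 : Continuous fun x : slopeConfigurations a b L p => x.1.2 :=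
      continuous_snd.comp continuous_subtype_val
    simp only [columnSlope]
    split_ifs
    · exact continuous_const.add hx1
    · exact hx2
    · exact continuous_const
  · have hpa : p ≠ a := fun h' => hga (h' ▸ hp)
    have hpb : p ≠ b := fun h' => hgb (h' ▸ hp)
    have hmp : ∀ x : slopeConfigurations a b L p, columnSlope a b L p₀ x.1.1.1 x.1.2 p = 1 :=
      fun x => by rw [columnSlope, if_pos hp, x.1.1.2.1, add_zero]
    have hkp : columnExponent a b L p₀ p = 1 := if_pos hp
    have key : ∀ q, q ≠ p → q ≠ a → q ≠ b → columnExponent a b L p₀ q = 1 →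
        columnSlope a b L p₀ x.1.1.1 x.1.2 q = columnSlope a b L p₀ y.1.1.1 y.1.2 q := by
      intro q hqp hqa hqb hk
      have := eq_of_limitPoint_eq (hm x) (hm y) hd (congrArg Subtype.val hxy) hqp hqa hqb hpa hpb
        (hk.trans hkp.symm)
      rwa [hmp, hmp, mul_one, one_mul] at this
    refine Subtype.ext (Prod.ext (Subtype.ext (funext fun q => ?_)) ?_)
    · by_cases hq : q ∈ genericColumns a b L
      · by_cases hqp : q = p
        · rw [hqp, x.1.1.2.1, y.1.1.2.1]
        · have := key q hqp (fun h' => hga (h' ▸ hq)) (fun h' => hgb (h' ▸ hq)) (if_pos hq)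
          simpa only [columnSlope, if_pos hq, add_right_inj] using this
      · rw [x.1.1.2.2.1 q hq, y.1.1.2.2.1 q hq]
    · have := key p₀ (fun h' => hp₀ (h' ▸ hp)) hp₀a hp₀b (by
        rw [columnExponent, if_neg hp₀, if_pos rfl])
      simpa only [columnSlope, if_neg hp₀, if_true] using this

/-- A homeomorphism would embed an open subset of `slopeSpace × ℂ` into `slopeSpace`. -/
theorem isEmpty_homeomorph_of_zero_column (hab : (a, b) ∈ σ) (hL : L ∈ stratum σ)
    {z w : Fin n → ℂ} (h : IsChartCoord a b L z w) (hz₀ : z p₀ = 0) (hw₀ : w p₀ = 0)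
    (hp : p ∈ genericColumns a b L) : IsEmpty (ParameterSpace σ ≃ₜ virtualSpace σ a b) := by
  classical
  refine ⟨fun f => ?_⟩
  obtain ⟨g, hgc, hgi⟩ := exists_continuous_injective_virtualSpace hab hL h hz₀ hw₀ hp
  obtain ⟨φ, hφc, hφi⟩ := exists_continuous_injective_slopeSpace hab hL hp
  let U := slopeConfigurations a b L p
  let F : slopeSpace a b L p × ℂ → slopeSpace a b L p := fun x =>
    if hx : x ∈ U then φ (f.symm (g ⟨x, hx⟩)) else 0
  have hF : ∀ x : U, F x = φ (f.symm (g x)) := fun x => dif_pos x.2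
  have hFc : ContinuousOn F U := by
    rw [continuousOn_iff_continuous_domRestrict]
    exact (hφc.comp (f.symm.continuous.comp hgc)).congr fun x => (hF x).symm
  have hFi : Set.InjOn F U := by
    intro x hx y hy hxy
    rw [hF ⟨x, hx⟩, hF ⟨y, hy⟩] at hxy
    exact congrArg Subtype.val (hgi (f.symm.injective (hφi hxy)))
  have := finrank_le_of_continuousOn_injOn (isOpen_slopeConfigurations a b L p)
    (slopeConfigurations_nonempty hab hL hp) hFc hFi
  rw [Module.finrank_prod, Complex.finrank_real_complex] at this
  omega

end ZeroColumn

end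

end GrassmannOrbit

theorem mainTheorem6 (n : ℕ) (hn : 5 ≤ n) (x : GrassmannOrbit.OrbitSpace n)
    (hx : GrassmannOrbit.IsCritical x) : GrassmannOrbit.IsSingular x := by
  open GrassmannOrbit in
  rintro σ ⟨L₀, hL₀, hL₀x⟩ a b hab
  obtain ⟨L, hLx, hcrit⟩ := hx
  have hL : L ∈ stratum σ := by
    obtain ⟨t, ht⟩ := MulAction.orbitRel_apply.1 (Quotient.exact (hLx.trans hL₀x.symm))
    refine mem_stratum_of_pluckerNeZero_iff hL₀ fun i j => ?_
    rw [← show t • L₀ = L from ht, circle_smul_eq, pluckerNeZero_smul_iff]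
  obtain ⟨hlt, hP⟩ := pluckerNeZero_of_mem_index hL hab
  obtain ⟨z, w, h⟩ := exists_isChartCoord hP
  by_cases hzw : ∀ p, z p = 0 ∨ w p = 0
  · have := subsingleton_parameterSpace hab hL h hzw
    have := nontrivial_virtualSpace hn hlt.ne hL h hzw
    exact ⟨fun f => not_subsingleton _ f.symm.injective.subsingleton⟩
  · obtain ⟨p₀, hz₀, hw₀⟩ := (exists_eq_zero_or_forall_mul_eq_zero h hcrit).resolve_right hzw
    push Not at hzw
    obtain ⟨p, hp⟩ := hzw
    exact isEmpty_homeomorph_of_zero_column hab hL h hz₀ hw₀ (h.mem_genericColumns_iff.2 hp)
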